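/- **Theorem (Unbounded categoricity down for $\Pi^1_2$).** Let $\kappa$ be a $\Pi^1_2$-indescribable cardinal and let $(K,\prec)$ be an abstract elementary class with $LS(K)<\kappa$ that is categorical in $\kappa$. Then for every cardinal $\lambda<\kappa$ there is a cardinal $\mu$ with $\lambda<\mu<\kappa$ such that $K$ is categorical in $\mu$. Here the following definitions are used. * A cardinal $\kappa$ is *$\Pi^1_2$-indescribable* if for every $U\subseteq V_\kappa$ and every $\Pi^1_2$ sentence $\varphi$ in the language $\{\in,U\}$: if $\langle V_\kappa,\in,U\rangle\models\varphi$, then $\langle V_\alpha,\in,U\cap V_\alpha\rangle\models\varphi$ for some ordinal $\alpha<\kappa$. A $\Pi^1_2$ sentence is one of the form $\forall X_1\cdots\forall X_k\,\exists Y_1\cdots\exists Y_l\,\psi$, where the $X_i,Y_j$ are second-order variables, ranging over all subsets of the domain, and $\psi$ has only first-order quantifiers. * An *abstract elementary class* (AEC) in a language $L$ is a class $K$ of $L$-structures with a partial order $\prec$ on $K$ such that: $M\prec N$ implies that $M$ is a substructure of $N$; $K$ and $\prec$ are closed under isomorphism; if $M_0\prec M_2$, $M_1\prec M_2$ and $M_0\subseteq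 M_1$, then $M_0\prec M_1$; if $\langle M_i:i<\alpha\rangle$, $\alpha>0$, is a $\prec$-increasing continuous chain in $K$ with union $M$, then $M\in K$, $M_i\prec M$ for all $i<\alpha$, and $M\prec N$ whenever $N\in K$ satisfies $M_i\prec N$ for all $i<\alpha$; and there is a cardinal $\chi\ge|L|+\aleph_0$ such that for all $M\in K$ and $A\subseteq|M|$ there is $N\prec M$ with $A\subseteq|N|$ and $\|N\|\le|A|+\chi$. The least such $\chi$ is the Löwenheim–Skolem number $LS(K)$. * $K$ is *categorical* in a cardinal $\mu$ if, up to isomorphism, $K$ has exactly one model of cardinality $\mu$. -/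

import Mathlib

open Cardinal
open scoped FirstOrder ZFSet

universe u

/-! ### `Π¹₂`-indescribable cardinals -/

/-- Relation symbols `∈` (binary), `U` (unary) and `n` second-order variables (unary). -/
inductive RankRel (n : ℕ) : ℕ → Type
  | mem : RankRel n 2
  | pred : RankRel n 1
  | var (i : Fin n) : RankRel n 1

/-- The language of `⟨V_α, ∈, U⟩` together with `n` second-order variables. A first-order sentence
of it is a formula in the language `{∈, U}` without second-order quantifiers, whose free variables
are `n` second-order ones. -/
def rankLanguage (n : ℕ) : FirstOrder.Language.{0, 0} where
  Functions := fun _ => Empty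
  Relations := RankRel n

/-- The structure `⟨V_α, ∈, U ∩ V_α⟩`, where the second-order variables have the values `X i`. -/
@[reducible] def rankStructure (α : Ordinal.{u}) (U : Set ZFSet.{u}) {n : ℕ}
    (X : Fin n → Set {x : ZFSet.{u} // x ∈ V_ α}) :
    (rankLanguage n).Structure {x : ZFSet.{u} // x ∈ V_ α} where
  funMap := fun f => Empty.elim f
  RelMap := fun r =>
    match r with
    | RankRel.mem => fun v => (v 0).1 ∈ (v 1).1
    | RankRel.pred => fun v => (v 0).1 ∈ U
    | RankRel.var i => fun v => v 0 ∈ X i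

/-- A `Π¹₂` sentence in the language `{∈, U}`: it has the form
`∀ X₁ ⋯ X_k ∃ Y₁ ⋯ Y_l, ψ` with second-order variables `Xᵢ`, `Yⱼ` (ranging over subsets of the
domain) and `ψ` without second-order quantifiers. -/
structure PiOneTwoSentence where
  k : ℕ
  l : ℕ
  matrix : (rankLanguage (k + l)).Sentence

/-- `⟨V_α, ∈, U ∩ V_α⟩ ⊨ φ`, in full second-order semantics. -/
def PiOneTwoSentence.Holds (φ : PiOneTwoSentence) (α : Ordinal.{u}) (U : Set ZFSet.{u}) : Prop :=
  ∀ X : Fin φ.k → Set {x : ZFSet.{u} // x ∈ V_ α},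
    ∃ Y : Fin φ.l → Set {x : ZFSet.{u} // x ∈ V_ α},
      letI := rankStructure α U (Fin.append X Y)
      {x : ZFSet.{u} // x ∈ V_ α} ⊨ φ.matrix

/-- `κ` is `Π¹₂`-indescribable: every `Π¹₂` sentence that is true in `⟨V_κ, ∈, U⟩` for some
`U ⊆ V_κ` is true in `⟨V_α, ∈, U ∩ V_α⟩` for some `α < κ`. -/
def IsPiOneTwoIndescribable (κ : Cardinal.{u}) : Prop :=
  ∀ U : Set ZFSet.{u}, (∀ x ∈ U, x ∈ V_ κ.ord) → ∀ φ : PiOneTwoSentence,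
    φ.Holds κ.ord U → ∃ α < κ.ord, φ.Holds α U

/-! ### Abstract elementary classes -/

/-- For substructures `S` and `T` of `N`, the intersection `S ∩ T` as a substructure of `T`; if
`S ≤ T`, this is `S` itself, seen as a substructure of `T`. -/
def FirstOrder.Language.Substructure.within {L : FirstOrder.Language.{u, u}} {N : Type u} [L.Structure N]
    (S T : L.Substructure N) : L.Substructure T :=
  S.comap T.subtype.toHom

/-- Given a relation `prec` (where `prec N S` says that the substructure `S` of `N` satisfies
`S ≺ N`), the substructures `S i` of `N`, for `i < α`, form a `≺`-increasing continuous chain. -/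
structure IsContinuousChain {L : FirstOrder.Language.{u, u}}
    (prec : ∀ (N : Type u) [L.Structure N], L.Substructure N → Prop)
    (N : Type u) [L.Structure N] (α : Ordinal.{u}) (S : Ordinal.{u} → L.Substructure N) :
    Prop where
  le : ∀ i j, i ≤ j → j < α → S i ≤ S j
  prec : ∀ i j, i ≤ j → j < α → prec (S j) ((S i).within (S j))
  continuous : ∀ i < α, Order.IsSuccLimit i → (S i : Set N) = ⋃ j < i, (S j : Set N)

/-- `μ` is at least `|L| + ℵ₀`, and every subset `A` of a model `M` is contained in some `S ≺ M` of
cardinality at most `|A| + μ`. -/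
def IsLowenheimSkolemBound {L : FirstOrder.Language.{u, u}}
    (mem : ∀ (M : Type u) [L.Structure M], Prop)
    (prec : ∀ (N : Type u) [L.Structure N], L.Substructure N → Prop) (μ : Cardinal.{u}) : Prop :=
  L.card + ℵ₀ ≤ μ ∧ ∀ (M : Type u) [L.Structure M], mem M → ∀ A : Set M,
    ∃ S : L.Substructure M, A ⊆ S ∧ prec M S ∧ #S ≤ #A + μ

/-- An abstract elementary class `(K, ≺)` in the language `L`. Here `mem M` says that `M ∈ K`, and
`prec N S` says that the substructure `S` of `N` satisfies `S ≺ N`. -/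
structure AEC (L : FirstOrder.Language.{u, u}) where
  mem : ∀ (M : Type u) [L.Structure M], Prop
  prec : ∀ (N : Type u) [L.Structure N], L.Substructure N → Prop
  /-- `≺` is a relation on `K`. -/
  mem_of_prec : ∀ (N : Type u) [L.Structure N] (S : L.Substructure N), prec N S → mem S ∧ mem N
  /-- `≺` is reflexive and transitive (it is antisymmetric because it refines `⊆`). -/
  prec_refl : ∀ (N : Type u) [L.Structure N], mem N → prec N ⊤
  prec_trans : ∀ (N : Type u) [L.Structure N] (S T : L.Substructure N), S ≤ T →
    prec T (S.within T) → prec N T → prec N S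
  /-- Closure of `K` and `≺` under isomorphisms. -/
  mem_iso : ∀ (N N' : Type u) [L.Structure N] [L.Structure N'], (N ≃[L] N') → mem N → mem N'
  prec_iso : ∀ (N N' : Type u) [L.Structure N] [L.Structure N'] (f : N ≃[L] N')
    (S : L.Substructure N), prec N S → prec N' (S.map f.toHom)
  /-- Coherence. -/
  coherence : ∀ (N : Type u) [L.Structure N] (S T : L.Substructure N), S ≤ T →
    prec N S → prec N T → prec T (S.within T)
  /-- Tarski–Vaught axioms. The union of a chain is a structure `N` that has the members of the
  chain as substructures and is covered by them. -/
  chain_union : ∀ (N : Type u) [L.Structure N] (α : Ordinal.{u}) (S : Ordinal.{u} →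
    L.Substructure N), 0 < α → IsContinuousChain prec N α S →
    (⋃ i < α, (S i : Set N)) = Set.univ → mem N ∧ ∀ i < α, prec N (S i)
  chain_union_prec : ∀ (N : Type u) [L.Structure N] (α : Ordinal.{u}) (S : Ordinal.{u} →
    L.Substructure N), 0 < α → IsContinuousChain prec N α S → mem N → (∀ i < α, prec N (S i)) →
    ∀ T : L.Substructure N, (T : Set N) = ⋃ i < α, (S i : Set N) → prec N T
  /-- The Löwenheim–Skolem number exists. -/
  exists_lowenheimSkolem : ∃ μ : Cardinal.{u}, IsLowenheimSkolemBound mem prec μ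

namespace AEC

variable {L : FirstOrder.Language.{u, u}}

/-- The Löwenheim–Skolem number `LS(K)`: the least cardinal with the Löwenheim–Skolem property. -/
noncomputable def LS (K : AEC L) : Cardinal.{u} :=
  sInf {μ | IsLowenheimSkolemBound K.mem K.prec μ}

/-- `K` is categorical in `μ`: up to isomorphism it has exactly one model of cardinality `μ`. -/
def Categorical (K : AEC L) (μ : Cardinal.{u}) : Prop :=
  (∃ (M : Type u) (_ : L.Structure M), K.mem M ∧ #M = μ) ∧
    ∀ (M N : Type u) [L.Structure M] [L.Structure N], K.mem M → K.mem N → #M = μ → #N = μ →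
      Nonempty (M ≃[L] N)

end AEC

/-! Let χ be the maximum of LS(K) and the given cardinal ν, and fix a set X of cardinality χ. A
model of cardinality at least χ is a directed union of strong submodels of cardinality χ, so it is
presented by an atlas: charts on structures with universe X, directed by strong embeddings
(`exists_isAtlas`). Conversely, the limit of an atlas lies in K (`IsAtlas.mem`), since closure under
continuous chains yields closure under directed unions. Above χ, the class is thus determined by the
strong embeddings between structures on X.

Pairs of a structure on X and a point of X can be coded by subsets of χ (`exists_code`). The graphs
of strong embeddings and of partial isomorphisms then form a single predicate U ⊆ V_κ, and L itself
need not be mentioned in any formula. An atlas with universe α is coded by a subset of V_α, and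
being such a code is first-order over ⟨V_α, ∈, U⟩. Uniqueness of the model becomes: for all atlases
F, F' there is a permutation H of α that induces a member of U between each chart of F and each
chart of F'. Checking charts is enough because symbols are finitary. This sentence is Π¹₂.

By categoricity it holds at κ, hence at some α < κ. Further clauses make α a limit, and a third
universal variable A rules out maps from a set of size χ onto α, so χ < |α|. Read back at α
(`nonempty_equiv_of_categoricityMatrix`), the sentence gives uniqueness in |α|; existence follows
from the model of size κ by Löwenheim–Skolem. -/

namespace FirstOrder.Language.Substructure

variable {L : FirstOrder.Language.{u, u}} {N : Type u} [L.Structure N]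

/-- If `T ≤ R`, then `T` is isomorphic to `T`, seen as a substructure of `R`. -/
def withinEquiv {T R : L.Substructure N} (h : T ≤ R) : T ≃[L] T.within R where
  toFun x := ⟨⟨x.1, h x.2⟩, x.2⟩
  invFun x := ⟨x.1.1, x.2⟩
  left_inv _ := rfl
  right_inv _ := rfl
  map_fun' _ _ := rfl
  map_rel' _ _ := Iff.rfl

theorem mem_within {S T : L.Substructure N} {x : T} : x ∈ S.within T ↔ x.1 ∈ S := Iff.rfl

end FirstOrder.Language.Substructure

/-! ### Strong substructures and chains inside an ambient structure -/

namespace AEC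

open FirstOrder.Language FirstOrder.Language.Substructure

variable {L : FirstOrder.Language.{u, u}} (K : AEC L) {N : Type u} [L.Structure N]

theorem prec_of_equiv {N' : Type u} [L.Structure N'] (e : N ≃[L] N') {S : L.Substructure N}
    {T : L.Substructure N'} (h : ∀ x, x ∈ S ↔ e x ∈ T) (hS : K.prec N S) : K.prec N' T := by
  convert K.prec_iso N N' e S hS
  ext y
  rw [Substructure.mem_map]
  constructor
  · intro hy
    exact ⟨e.symm y, (h _).2 (by simpa using hy), by simp⟩
  · rintro ⟨x, hx, rfl⟩
    exact (h x).1 hx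

/-- The strong substructure relation between two substructures of an ambient structure. -/
def Le (S T : L.Substructure N) : Prop := S ≤ T ∧ K.prec T (S.within T)

variable {K} {S T R : L.Substructure N}

theorem Le.mem_right (h : K.Le S T) : K.mem T := (K.mem_of_prec _ _ h.2).2

/-- Invariance under isomorphism: `T.within R` is a copy of `T`, so the relation does not depend on
the structure in which it is viewed. -/
theorem le_within_iff (h : S ≤ T) (hT : T ≤ R) :
    K.prec (T.within R) ((S.within R).within (T.within R)) ↔ K.Le S T := by
  constructor
  · intro h'
    exact ⟨h, K.prec_of_equiv (withinEquiv hT).symm (fun x => Iff.rfl) h'⟩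
  · intro h'
    exact K.prec_of_equiv (withinEquiv hT) (fun x => Iff.rfl) h'.2

theorem Le.refl (h : K.mem S) : K.Le S S := by
  refine ⟨le_rfl, ?_⟩
  convert K.prec_refl _ h
  ext x
  simp [mem_within]

theorem Le.trans (h : K.Le S T) (h' : K.Le T R) : K.Le S R :=
  ⟨h.1.trans h'.1, K.prec_trans _ _ _ (fun _ hx => h.1 hx) ((le_within_iff h.1 h'.1).2 h) h'.2⟩

theorem le_of_prec (hST : S ≤ T) (hS : K.prec N S) (hT : K.prec N T) : K.Le S T :=
  ⟨hST, K.coherence N S T hST hS hT⟩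

section Chain

variable {α : Ordinal.{u}} {C : Ordinal.{u} → L.Substructure N}

theorem isContinuousChain_within (hC : ∀ i j, i ≤ j → j < α → K.Le (C i) (C j))
    (hcont : ∀ i < α, Order.IsSuccLimit i → (C i : Set N) = ⋃ j < i, (C j : Set N))
    (hR : ∀ i < α, C i ≤ R) : IsContinuousChain K.prec R α fun i => (C i).within R where
  le i j hij hj _ hx := (hC i j hij hj).1 hx
  prec i j hij hj := (le_within_iff (hC i j hij hj).1 (hR j hj)).2 (hC i j hij hj)
  continuous i hi hl := by
    ext x
    simpa [mem_within] using Set.ext_iff.1 (hcont i hi hl) x.1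

/-- The chain axiom is applied inside `T`, because the ambient `N` is not known to belong to `K`. -/
theorem le_of_chain (hα : 0 < α) (hC : ∀ i j, i ≤ j → j < α → K.Le (C i) (C j))
    (hcont : ∀ i < α, Order.IsSuccLimit i → (C i : Set N) = ⋃ j < i, (C j : Set N))
    (hT : (T : Set N) = ⋃ i < α, (C i : Set N)) : K.mem T ∧ ∀ i < α, K.Le (C i) T := by
  have hle : ∀ i < α, C i ≤ T := fun i hi x hx => by
    change x ∈ (T : Set N)
    rw [hT]
    simp only [Set.mem_iUnion]
    exact ⟨i, hi, hx⟩
  obtain ⟨h1, h2⟩ := K.chain_union T α _ hα (isContinuousChain_within hC hcont hle) (by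
    ext x
    simpa [mem_within] using Set.ext_iff.1 hT x.1)
  exact ⟨h1, fun i hi => ⟨hle i hi, h2 i hi⟩⟩

theorem chain_le (hα : 0 < α) (hC : ∀ i j, i ≤ j → j < α → K.Le (C i) (C j))
    (hcont : ∀ i < α, Order.IsSuccLimit i → (C i : Set N) = ⋃ j < i, (C j : Set N))
    (hT : (T : Set N) = ⋃ i < α, (C i : Set N)) (hR : ∀ i < α, K.Le (C i) R) : K.Le T R := by
  refine ⟨fun x hx => ?_, ?_⟩
  · have : x ∈ (T : Set N) := hx
    rw [hT] at this
    simp only [Set.mem_iUnion] at this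
    obtain ⟨i, hi, h⟩ := this
    exact (hR i hi).1 h
  · refine K.chain_union_prec R α _ hα
      (isContinuousChain_within hC hcont fun i hi => (hR i hi).1) (hR 0 hα).mem_right
      (fun i hi => (hR i hi).2) _ ?_
    ext x
    simpa [mem_within] using Set.ext_iff.1 hT x.1

end Chain

/-! ### Closure under directed unions -/

section FinsetSystem

/-- The union of the members of a family of substructures whose index is a finite subset
of `A`. -/
def finsetUnion (S : Finset N → L.Substructure N) (A : Set N) : L.Substructure N :=
  ⨆ a : {a : Finset N // (a : Set N) ⊆ A}, S a

variable {S : Finset N → L.Substructure N}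

theorem mem_finsetUnion (hS : ∀ a b, a ⊆ b → S a ≤ S b) {A : Set N} {x : N} :
    x ∈ finsetUnion S A ↔ ∃ a : Finset N, (a : Set N) ⊆ A ∧ x ∈ S a := by
  classical
  have : Nonempty {a : Finset N // (a : Set N) ⊆ A} := ⟨⟨∅, by simp⟩⟩
  rw [finsetUnion, mem_iSup_of_directed]
  · simp
  · rintro ⟨a, ha⟩ ⟨b, hb⟩
    exact ⟨⟨a ∪ b, by simp [ha, hb]⟩, hS _ _ Finset.subset_union_left,
      hS _ _ Finset.subset_union_right⟩

theorem finsetUnion_coe (hS : ∀ a b, a ⊆ b → S a ≤ S b) (a : Finset N) :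
    finsetUnion S a = S a := by
  ext x
  rw [mem_finsetUnion hS]
  exact ⟨fun ⟨b, hb, hx⟩ => hS _ _ (by simpa using hb) hx, fun hx => ⟨a, subset_rfl, hx⟩⟩

/-- Finitely many ordinals below a limit are bounded below it; this is the continuity of the chains
used next. -/
theorem finsetUnion_lt (hS : ∀ a b, a ⊆ b → S a ≤ S b) (A : Set N) (ρ : N → Ordinal.{u})
    {i : Ordinal.{u}} (hi : Order.IsSuccLimit i) :
    (finsetUnion S {x ∈ A | ρ x < i} : Set N) =
      ⋃ j < i, (finsetUnion S {x ∈ A | ρ x < j} : Set N) := by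
  ext x
  simp only [SetLike.mem_coe, Set.mem_iUnion, mem_finsetUnion hS]
  constructor
  · rintro ⟨a, ha, hx⟩
    refine ⟨Order.succ (a.sup ρ), hi.succ_lt ?_, a, fun y hy => ⟨(ha hy).1, ?_⟩, hx⟩
    · rw [Finset.sup_lt_iff hi.bot_lt]
      exact fun y hy => (ha hy).2
    · exact Order.lt_succ_of_le (Finset.le_sup hy)
  · rintro ⟨j, hj, a, ha, hx⟩
    exact ⟨a, fun y hy => ⟨(ha hy).1, (ha hy).2.trans hj⟩, hx⟩

/-- Induction on `#A`: a finite `A` is itself an index, and an infinite one is enumerated in type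
`(#A).ord`, so that its proper initial segments are smaller and form a continuous chain. The case `B
= A` contains membership in `K`. -/
theorem finsetUnion_le (hS : ∀ a b, a ⊆ b → K.Le (S a) (S b)) (A : Set N) :
    ∀ B ⊆ A, K.Le (finsetUnion S B) (finsetUnion S A) := by
  have hS' : ∀ a b, a ⊆ b → S a ≤ S b := fun a b h => (hS a b h).1
  induction hc : #A using WellFoundedLT.induction generalizing A with
  | ind c ih =>
  subst hc
  intro B hBA
  rcases A.finite_or_infinite with hA | hA
  · obtain ⟨a, rfl⟩ := hA.exists_finset_coe
    obtain ⟨b, rfl⟩ := (hA.subset hBA).exists_finset_coe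
    rw [finsetUnion_coe hS', finsetUnion_coe hS']
    exact hS _ _ (by simpa using hBA)
  · classical
    have hinf : ℵ₀ ≤ #A := by
      have := hA.to_subtype
      exact Cardinal.aleph0_le_mk A
    obtain ⟨e⟩ : Nonempty (A ≃ (#A).ord.ToType) := Cardinal.eq.1 (by simp)
    let ρ : N → Ordinal.{u} := fun x => if h : x ∈ A then (e ⟨x, h⟩).toOrd.1 else 0
    have hρ : ∀ x (h : x ∈ A), ρ x = (e ⟨x, h⟩).toOrd.1 := fun x h => by simp [ρ, h]
    have hlim : Order.IsSuccLimit (#A).ord := Cardinal.isSuccLimit_ord hinf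
    have hlt : ∀ x ∈ A, ρ x < (#A).ord := fun x h => by
      rw [hρ x h]
      exact (e ⟨x, h⟩).toOrd.2
    have hsmall : ∀ D ⊆ A, ∀ i < (#A).ord, #{x ∈ D | ρ x < i} < #A := by
      intro D hD i hi
      refine lt_of_le_of_lt ?_ (Cardinal.lt_ord.1 hi)
      rw [← Cardinal.mk_toType i]
      refine Cardinal.mk_le_of_injective
        (f := fun x => Ordinal.ToType.mk ⟨ρ x.1, x.2.2⟩) ?_
      intro x y hxy
      have h1 : ρ x.1 = ρ y.1 :=
        congrArg Subtype.val (Ordinal.ToType.mk.injective hxy)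
      rw [hρ _ (hD x.2.1), hρ _ (hD y.2.1)] at h1
      have h2 := e.injective (Ordinal.ToType.mk.symm.injective (Subtype.ext h1))
      exact Subtype.ext (Subtype.mk.inj h2)
    have hall : ∀ D ⊆ A, {x ∈ D | ρ x < (#A).ord} = D := fun D hD =>
      Set.sep_eq_self_iff_mem_true.2 fun x hx => hlt x (hD hx)
    have hmono : ∀ D ⊆ A, ∀ i j, i ≤ j → j < (#A).ord →
        K.Le (finsetUnion S {x ∈ D | ρ x < i}) (finsetUnion S {x ∈ D | ρ x < j}) := by
      intro D hD i j hij hj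
      exact ih _ (hsmall D hD j hj) _ rfl _ fun x hx => ⟨hx.1, hx.2.trans_le hij⟩
    have hcont : ∀ D : Set N, ∀ i < (#A).ord, Order.IsSuccLimit i →
        (finsetUnion S {x ∈ D | ρ x < i} : Set N) =
          ⋃ j < i, (finsetUnion S {x ∈ D | ρ x < j} : Set N) :=
      fun D i _ hi => finsetUnion_lt hS' D ρ hi
    have hunion : ∀ D ⊆ A, (finsetUnion S D : Set N) =
        ⋃ j < (#A).ord, (finsetUnion S {x ∈ D | ρ x < j} : Set N) := by
      intro D hD
      rw [← finsetUnion_lt hS' D ρ hlim, hall D hD]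
    have hA' := (le_of_chain hlim.bot_lt (hmono A subset_rfl) (hcont A) (hunion A subset_rfl)).2
    -- `B` is cut by the enumeration of `A`, so each piece of `B` lies in a piece of `A`, which is
    -- already strong in the whole.
    refine chain_le hlim.bot_lt (hmono B hBA) (hcont B) (hunion B hBA) fun i hi => ?_
    refine Le.trans ?_ (hA' i hi)
    exact ih _ (hsmall A subset_rfl i hi) _ rfl _ fun x hx => ⟨hBA hx.1, hx.2⟩

theorem mem_of_finset_system (hS : ∀ a b, a ⊆ b → K.Le (S a) (S b))
    (hcov : ∀ x, ∃ a, x ∈ S a) : K.mem N := by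
  have h := (finsetUnion_le hS Set.univ Set.univ subset_rfl).mem_right
  have htop : finsetUnion S Set.univ = ⊤ := by
    ext x
    simp [mem_finsetUnion fun a b h => (hS a b h).1, hcov]
  rw [htop] at h
  exact K.mem_iso _ _ topEquiv h

/-- Strong recursion: `G b` is chosen above the finitely many `G a` with `a ⊂ b`. -/
theorem exists_finset_system {N I : Type*} (P : Finset N → I → Prop) (r : I → I → Prop)
    (h : ∀ (a : Finset N) (s : Finset I), ∃ k, P a k ∧ ∀ i ∈ s, r i k) :
    ∃ G : Finset N → I, (∀ a, P a (G a)) ∧ ∀ a b, a ⊂ b → r (G a) (G b) := by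
  classical
  choose ub hP hr using h
  let F : ∀ a : Finset N, (∀ b ⊂ a, I) → I := fun a g =>
    ub a (a.ssubsets.attach.image fun b => g b.1 (Finset.mem_ssubsets.1 b.2))
  have hF : ∀ a, Finset.strongInduction F a =
      ub a (a.ssubsets.attach.image fun b => Finset.strongInduction F b.1) :=
    fun a => Finset.strongInduction_eq F a
  refine ⟨Finset.strongInduction F, fun a => ?_, fun a b hab => ?_⟩
  · rw [hF]
    exact hP _ _
  · rw [hF b]
    refine hr _ _ _ (Finset.mem_image.2 ⟨⟨a, Finset.mem_ssubsets.2 hab⟩, by simp, rfl⟩)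

theorem exists_upper_bound {I : Type*} [Nonempty I] (r : I → I → Prop)
    (htr : ∀ i j k, r i j → r j k → r i k) (hd : ∀ i j, ∃ k, r i k ∧ r j k) (s : Finset I) :
    ∃ k, ∀ i ∈ s, r i k := by
  classical
  induction s using Finset.induction with
  | empty => exact ⟨Classical.arbitrary I, by simp⟩
  | insert i s _ ih =>
    obtain ⟨k, hk⟩ := ih
    obtain ⟨l, hl, hl'⟩ := hd i k
    refine ⟨l, fun j hj => ?_⟩
    rcases Finset.mem_insert.1 hj with rfl | hj
    · exact hl
    · exact htr _ _ _ (hk j hj) hl'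

/-- Reindexing by finite subsets of `N` turns a directed system into a monotone one. -/
theorem mem_of_directed {I : Type*} [Nonempty I] (T : I → L.Substructure N)
    (hd : ∀ i j, ∃ k, K.Le (T i) (T k) ∧ K.Le (T j) (T k)) (hcov : ∀ x, ∃ i, x ∈ T i) :
    K.mem N := by
  classical
  choose c hc using hcov
  obtain ⟨G, hG, hG'⟩ := exists_finset_system (N := N) (fun a k => ∀ x ∈ a, x ∈ T k)
    (fun i j => K.Le (T i) (T j)) (fun a s => by
      obtain ⟨k, hk⟩ := exists_upper_bound (fun i j => K.Le (T i) (T j))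
        (fun _ _ _ h h' => h.trans h') hd (s ∪ a.image c)
      refine ⟨k, fun x hx => ?_, fun i hi => hk i (by simp [hi])⟩
      exact (hk (c x) (Finset.mem_union_right _ (Finset.mem_image_of_mem c hx))).1 (hc x))
  refine mem_of_finset_system (S := fun a => T (G a)) (fun a b hab => ?_)
    fun x => ⟨{x}, hG {x} x (by simp)⟩
  rcases hab.eq_or_ssubset with rfl | hab
  · obtain ⟨k, hk, -⟩ := hd (G a) (G a)
    exact Le.refl (K.mem_iso _ _ (withinEquiv hk.1).symm (K.mem_of_prec _ _ hk.2).1)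
  · exact hG' a b hab

end FinsetSystem

end AEC

/-! ### Atlases and their limits -/

namespace AEC

open FirstOrder.Language FirstOrder.Language.Substructure

variable {L : FirstOrder.Language.{u, u}}

/-- `f` is an embedding of the structure `s` into the structure `t`. -/
def IsEmb {X Y : Type u} (s : L.Structure X) (t : L.Structure Y) (f : X → Y) : Prop :=
  ∃ e : X ↪[L] Y, ⇑e = f

/-- `f` is an embedding of `s` into `t` whose range is a strong substructure. -/
def IsStrongEmb (K : AEC L) {X Y : Type u} (s : L.Structure X) (t : L.Structure Y) (f : X → Y) :
    Prop :=
  ∃ e : X ↪[L] Y, ⇑e = f ∧ K.prec Y e.toHom.range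

/-- `r` is a partial isomorphism between `s` and `t`. -/
def IsPartialIso {X Y : Type u} (s : L.Structure X) (t : L.Structure Y) (r : X → Y → Prop) :
    Prop :=
  (∀ (n : ℕ) (F : L.Functions n) (v : Fin n → X) (w : Fin n → Y) (x : X) (y : Y),
    (∀ k, r (v k) (w k)) → r x y →
      (Structure.funMap F v = x ↔ Structure.funMap F w = y)) ∧
  ∀ (n : ℕ) (R : L.Relations n) (v : Fin n → X) (w : Fin n → Y), (∀ k, r (v k) (w k)) →
    (Structure.RelMap R v ↔ Structure.RelMap R w)

/-- An atlas of a model with universe `O`: charts `f i : X → O` on structures `s i`, directed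
by strong embeddings. -/
structure IsAtlas (K : AEC L) {I : Type*} {X O : Type u} (s : I → L.Structure X)
    (f : I → X → O) : Prop where
  inj : ∀ i, Function.Injective (f i)
  cover : ∀ y, ∃ i x, f i x = y
  directed : ∀ i j, ∃ k, (∃ e, IsStrongEmb K (s i) (s k) e ∧ ∀ x, f k (e x) = f i x) ∧
    ∃ e, IsStrongEmb K (s j) (s k) e ∧ ∀ x, f k (e x) = f j x

variable {K : AEC L} {I : Type*} {X O : Type u} {s : I → L.Structure X} {f : I → X → O}

theorem IsEmb.funMap_eq {X Y : Type u} {s : L.Structure X} {t : L.Structure Y} {f : X → Y}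
    (h : IsEmb s t f) {n : ℕ} (F : L.Functions n) (v : Fin n → X) :
    f (Structure.funMap F v) = Structure.funMap F (f ∘ v) := by
  obtain ⟨e, rfl⟩ := h
  exact e.map_fun F v

theorem IsEmb.relMap_iff {X Y : Type u} {s : L.Structure X} {t : L.Structure Y} {f : X → Y}
    (h : IsEmb s t f) {n : ℕ} (R : L.Relations n) (v : Fin n → X) :
    Structure.RelMap R (f ∘ v) ↔ Structure.RelMap R v := by
  obtain ⟨e, rfl⟩ := h
  exact e.map_rel R v

theorem IsEmb.injective {X Y : Type u} {s : L.Structure X} {t : L.Structure Y} {f : X → Y}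
    (h : IsEmb s t f) : Function.Injective f := by
  obtain ⟨e, rfl⟩ := h
  exact e.injective

theorem IsStrongEmb.isEmb {X Y : Type u} {s : L.Structure X} {t : L.Structure Y} {f : X → Y}
    (h : IsStrongEmb K s t f) : IsEmb s t f := by
  obtain ⟨e, h, -⟩ := h
  exact ⟨e, h⟩

/-- Both charts embed into a third, whose injectivity identifies the two tuples there. -/
theorem IsAtlas.compat (h : IsAtlas K s f) {i j : I} {n : ℕ} {v w : Fin n → X}
    (hvw : f i ∘ v = f j ∘ w) :
    (∀ F : L.Functions n, f i ((s i).funMap F v) = f j ((s j).funMap F w)) ∧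
      ∀ R : L.Relations n, (s i).RelMap R v ↔ (s j).RelMap R w := by
  obtain ⟨k, ⟨d, hd, hd'⟩, e, he, he'⟩ := h.directed i j
  have hde : d ∘ v = e ∘ w := by
    funext m
    refine h.inj k ?_
    simpa [hd', he'] using congrFun hvw m
  constructor
  · intro F
    rw [← hd', ← he', hd.isEmb.funMap_eq, he.isEmb.funMap_eq, hde]
  · intro R
    rw [← hd.isEmb.relMap_iff, ← he.isEmb.relMap_iff, hde]

/-- A tuple is evaluated in any chart containing it, and `IsAtlas.compat` makes the choice
irrelevant. Every finite tuple lies in a chart, so the default value plays no role. -/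
theorem IsAtlas.exists_structure [Nonempty O] (h : IsAtlas K s f) :
    ∃ t : L.Structure O, ∀ i, IsEmb (s i) t (f i) := by
  classical
  let t : L.Structure O := {
    funMap := fun {n} F v => if h : ∃ y i w, v = f i ∘ w ∧ f i ((s i).funMap F w) = y
      then h.choose else Classical.arbitrary O
    RelMap := fun {n} R v => ∃ i w, v = f i ∘ w ∧ (s i).RelMap R w }
  refine ⟨t, fun i => ⟨@FirstOrder.Language.Embedding.mk L X O (s i) t ⟨f i, h.inj i⟩ ?_ ?_, rfl⟩⟩
  · intro n F v
    have hex : ∃ y j w, f i ∘ v = f j ∘ w ∧ f j ((s j).funMap F w) = y := ⟨_, i, v, rfl, rfl⟩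
    change _ = dite _ _ _
    rw [dif_pos hex]
    obtain ⟨j, w, hw, hy⟩ := hex.choose_spec
    exact ((h.compat hw).1 F).trans hy
  · intro n R v
    constructor
    · rintro ⟨j, w, hw, hR⟩
      exact ((h.compat hw).2 R).2 hR
    · intro hR
      exact ⟨i, v, rfl, hR⟩

theorem le_range {X Y : Type u} (s : L.Structure X) (s' : L.Structure Y) (t : L.Structure O)
    (e : X ↪[L] O) (e' : Y ↪[L] O) {d : X → Y} (hd : IsStrongEmb K s s' d)
    (h : ∀ x, e' (d x) = e x) : K.Le e.toHom.range e'.toHom.range := by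
  obtain ⟨d, rfl, hp⟩ := hd
  refine ⟨?_, K.prec_of_equiv e'.equivRange (fun x => ?_) hp⟩
  · intro y hy
    obtain ⟨x, rfl⟩ := Hom.mem_range.1 hy
    exact Hom.mem_range.2 ⟨_, h x⟩
  · rw [mem_within, Embedding.equivRange_apply, Hom.mem_range, Hom.mem_range]
    constructor
    · rintro ⟨y, rfl⟩
      exact ⟨y, (h y).symm⟩
    · rintro ⟨y, hy⟩
      exact ⟨y, e'.injective ((h y).trans hy)⟩

/-- A class is closed under direct limits of strong embeddings. -/
theorem IsAtlas.mem [Nonempty O] (h : IsAtlas K s f) (t : L.Structure O)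
    (ht : ∀ i, IsEmb (s i) t (f i)) : K.mem O := by
  have : Nonempty I := ⟨(h.cover (Classical.arbitrary O)).choose⟩
  choose e he using ht
  let T : I → L.Substructure O := fun i =>
    let _ := s i
    (e i).toHom.range
  have hT : ∀ i y, y ∈ T i ↔ ∃ x, f i x = y := by
    intro i y
    simp only [← he]
    let _ := s i
    exact Hom.mem_range
  have hle : ∀ i k d, IsStrongEmb K (s i) (s k) d → (∀ x, f k (d x) = f i x) →
      K.Le (T i) (T k) := by
    intro i k d hd h
    simp only [← he] at h
    exact le_range (s i) (s k) t (e i) (e k) hd h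
  refine mem_of_directed T (fun i j => ?_) fun y => ?_
  · obtain ⟨k, ⟨d, hd, hd'⟩, e, he, he'⟩ := h.directed i j
    exact ⟨k, hle i k d hd hd', hle j k e he he'⟩
  · obtain ⟨i, x, hx⟩ := h.cover y
    exact ⟨i, (hT i y).2 ⟨x, hx⟩⟩

theorem IsAtlas.exists_chart [Nonempty O] (h : IsAtlas K s f) (a : Finset O) :
    ∃ i, ∀ y ∈ a, ∃ x, f i x = y := by
  classical
  have : Nonempty I := ⟨(h.cover (Classical.arbitrary O)).choose⟩
  choose c hc using h.cover
  obtain ⟨k, hk⟩ := exists_upper_bound (fun i j => Set.range (f i) ⊆ Set.range (f j))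
    (fun _ _ _ h h' => h.trans h') (fun i j => by
      obtain ⟨k, ⟨d, -, hd⟩, e, -, he⟩ := h.directed i j
      exact ⟨k, Set.range_subset_iff.2 fun x => ⟨_, hd x⟩,
        Set.range_subset_iff.2 fun x => ⟨_, he x⟩⟩) (a.image c)
  exact ⟨k, fun y hy => hk (c y) (Finset.mem_image_of_mem c hy) (hc y)⟩

section Iso

variable {I' : Type*} {O' : Type u} {s' : I' → L.Structure X} {f' : I' → X → O'}

/-- Each instance of preservation involves finitely many points, which lie in one chart of either
atlas. Only charts that `g` relates somewhere are constrained, since the code of an empty relation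
does not determine its two structures. -/
theorem IsAtlas.nonempty_equiv [Nonempty O] (h : IsAtlas K s f) (h' : IsAtlas K s' f')
    (t : L.Structure O) (t' : L.Structure O') (ht : ∀ i, IsEmb (s i) t (f i))
    (ht' : ∀ i, IsEmb (s' i) t' (f' i)) (g : O ≃ O')
    (hg : ∀ i j, (∃ x y, g (f i x) = f' j y) →
      IsPartialIso (s i) (s' j) fun x y => g (f i x) = f' j y) : Nonempty (O ≃[L] O') := by
  classical
  have : Nonempty O' := ⟨g (Classical.arbitrary O)⟩
  have key : ∀ {n : ℕ} (v : Fin n → O) (y : O), ∃ (i : I) (j : I') (w : Fin n → X) (x : X)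
      (w' : Fin n → X) (x' : X), v = f i ∘ w ∧ y = f i x ∧ g ∘ v = f' j ∘ w' ∧ g y = f' j x' := by
    intro n v y
    obtain ⟨i, hi⟩ := h.exists_chart (insert y (Finset.univ.image v))
    obtain ⟨j, hj⟩ := h'.exists_chart (insert (g y) (Finset.univ.image (g ∘ v)))
    choose w hw using fun k => hi (v k) (by simp)
    choose w' hw' using fun k => hj (g (v k)) (Finset.mem_insert_of_mem
      (Finset.mem_image.2 ⟨k, Finset.mem_univ _, rfl⟩))
    obtain ⟨x, hx⟩ := hi y (by simp)
    obtain ⟨x', hx'⟩ := hj (g y) (by simp)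
    exact ⟨i, j, w, x, w', x', funext fun k => (hw k).symm, hx.symm,
      funext fun k => (hw' k).symm, hx'.symm⟩
  refine ⟨⟨g, ?_, ?_⟩⟩
  · intro n F v
    obtain ⟨i, j, w, x, w', x', h1, h2, h3, h4⟩ := key v (Structure.funMap F v)
    have hp := hg i j ⟨x, x', by rw [← h2, h4]⟩
    change g (Structure.funMap F v) = Structure.funMap F (g ∘ v)
    have := (hp.1 n F w w' x x' (fun k => by
      simpa [h1] using congrFun h3 k) (show g (f i x) = f' j x' by rw [← h2, h4])).1 (by
        apply h.inj i
        rw [(ht i).funMap_eq, ← h1, h2])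
    rw [h4, h3, ← (ht' j).funMap_eq, this]
  · intro n R v
    -- The extra point ensures that the two charts are related even if `n = 0`.
    obtain ⟨i, j, w, x, w', x', h1, h2, h3, h4⟩ := key v (Classical.arbitrary O)
    have hp := hg i j ⟨x, x', by rw [← h2, h4]⟩
    change Structure.RelMap R (g ∘ v) ↔ _
    have := hp.2 n R w w' (fun k => by simpa [h1] using congrFun h3 k)
    rw [h3, (ht' j).relMap_iff, ← this, ← (ht i).relMap_iff, ← h1]

theorem isPartialIso_of_equiv (t : L.Structure O) (t' : L.Structure O') (e : O ≃[L] O')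
    {s s' : L.Structure X} {f : X → O} {f' : X → O'} (h : IsEmb s t f) (h' : IsEmb s' t' f') :
    IsPartialIso s s' fun x y => e (f x) = f' y := by
  constructor
  · intro n F v w x y hvw hxy
    rw [← h.injective.eq_iff, ← h'.injective.eq_iff, h.funMap_eq, h'.funMap_eq, ← hxy,
      ← (show e ∘ (f ∘ v) = f' ∘ w from funext hvw), ← e.map_fun, e.injective.eq_iff]
  · intro n R v w hvw
    rw [← h.relMap_iff, ← h'.relMap_iff,
      ← (show e ∘ (f ∘ v) = f' ∘ w from funext hvw), e.map_rel]

end Iso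

theorem isEmb_inducedStructure (t : L.Structure O) (S : L.Substructure O) (e : S ≃ X) :
    IsEmb e.inducedStructure t fun x => (e.symm x : O) := by
  let _ : L.Structure X := e.inducedStructure
  exact ⟨S.subtype.comp e.inducedStructureEquiv.symm.toEmbedding, rfl⟩

theorem isStrongEmb_of_equiv {X Y : Type u} [L.Structure O] {S T : L.Substructure O}
    (h : K.Le S T) (s : L.Structure X) (t : L.Structure Y) (e : S ≃[L] X) (e' : T ≃[L] Y) :
    IsStrongEmb K s t fun x => e' (inclusion h.1 (e.symm x)) := by
  refine ⟨(e'.toEmbedding.comp (inclusion h.1)).comp e.symm.toEmbedding, rfl,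
    K.prec_of_equiv e' (fun x => ?_) h.2⟩
  rw [mem_within, Hom.mem_range]
  constructor
  · intro hx
    exact ⟨e ⟨x, hx⟩, congrArg e' (Subtype.ext (show ((e.symm (e ⟨x, hx⟩) : S) : O) = x by
      rw [e.symm_apply_apply]))⟩
  · rintro ⟨y, hy⟩
    rw [← e'.injective hy]
    exact (e.symm y).2

/-- Strong submodels `G a` of size `χ` are chosen increasing in the finite set `a ⊆ O`; coherence
makes the inclusions strong. -/
theorem exists_isAtlas {χ : Cardinal.{u}} (hχ : IsLowenheimSkolemBound K.mem K.prec χ)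
    (hX : #X = χ) (t : L.Structure O) (hO : K.mem O) (hcard : χ ≤ #O) (q : I → Finset O)
    (hq : Function.Surjective q) :
    ∃ (s : I → L.Structure X) (f : I → X → O), IsAtlas K s f ∧ ∀ i, IsEmb (s i) t (f i) := by
  classical
  have hχ' : ℵ₀ ≤ χ := le_trans (by simp) hχ.1
  -- Including `A₀` forces cardinality exactly `χ`, so that `X` can serve as the universe.
  obtain ⟨A₀, hA₀⟩ := Cardinal.le_mk_iff_exists_set.1 hcard
  obtain ⟨G, hG, hG'⟩ := exists_finset_system (N := O)
    (I := {S : L.Substructure O // K.prec O S ∧ #S = χ}) (fun a S => ∀ x ∈ a, x ∈ S.1)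
    (fun S T => S.1 ≤ T.1) (fun a s => by
      obtain ⟨S, hS, hS', hS''⟩ := hχ.2 O hO (A₀ ∪ ((a : Set O) ∪ ⋃ T ∈ s, (T.1 : Set O)))
      refine ⟨⟨S, hS', le_antisymm (hS''.trans ?_) ?_⟩, ?_, ?_⟩
      · refine Cardinal.add_le_of_le hχ' ((Cardinal.mk_union_le _ _).trans ?_) le_rfl
        refine Cardinal.add_le_of_le hχ' hA₀.le ((Cardinal.mk_union_le _ _).trans ?_)
        refine Cardinal.add_le_of_le hχ' ?_ ?_
        · exact (Cardinal.lt_aleph0_of_finite _).le.trans hχ'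
        · clear hS hS''
          induction s using Finset.induction with
          | empty => simp
          | insert T s _ ih =>
            rw [Finset.set_biUnion_insert]
            exact (Cardinal.mk_union_le _ _).trans (Cardinal.add_le_of_le hχ' T.2.2.le ih)
      · rw [← hA₀]
        exact Cardinal.mk_le_mk_of_subset (Set.subset_union_left.trans hS)
      · exact fun x hx => hS (Or.inr (Or.inl hx))
      · intro T hT x hx
        exact hS (Or.inr (Or.inr (Set.mem_biUnion hT hx))))
  have hmono : ∀ a b, a ⊆ b → (G a).1 ≤ (G b).1 := by
    intro a b hab
    rcases hab.eq_or_ssubset with rfl | hab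
    · exact le_rfl
    · exact hG' a b hab
  have e : ∀ a, Nonempty ((G a).1 ≃ X) := fun a => Cardinal.eq.1 ((G a).2.2.trans hX.symm)
  replace e := fun a => (e a).some
  have hstrong : ∀ a b, a ⊆ b → ∃ d, IsStrongEmb K (e a).inducedStructure
      (e b).inducedStructure d ∧ ∀ x, ((e b).symm (d x) : O) = (e a).symm x := fun a b hab =>
    ⟨_, isStrongEmb_of_equiv
      (le_of_prec (hmono a b hab) (G a).2.1 (G b).2.1) (e a).inducedStructure
      (e b).inducedStructure (e a).inducedStructureEquiv (e b).inducedStructureEquiv,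
      fun x => congrArg Subtype.val ((e b).symm_apply_apply _)⟩
  refine ⟨fun i => (e (q i)).inducedStructure, fun i x => (e (q i)).symm x,
    ⟨fun i => ?_, fun y => ?_, fun i j => ?_⟩, fun i => isEmb_inducedStructure t _ _⟩
  · exact Subtype.val_injective.comp (e _).symm.injective
  · obtain ⟨i, hi⟩ := hq {y}
    exact ⟨i, e (q i) ⟨y, hG _ _ (by simp [hi])⟩, by simp⟩
  · obtain ⟨k, hk⟩ := hq (q i ∪ q j)
    exact ⟨k, hstrong _ _ (by simp [hk]), hstrong _ _ (by simp [hk])⟩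

end AEC

/-! ### First-order definability, uniformly in α -/

/-- The domain of `⟨V_α, ∈⟩`. -/
abbrev RankDomain (α : Ordinal.{u}) : Type (u + 1) := {x : ZFSet.{u} // x ∈ V_ α}

/-- `P` is defined by a formula without second-order quantifiers, uniformly in `α`. -/
def IsExpressible (U : Set ZFSet.{u}) {n : ℕ} {ι : Type}
    (P : ∀ α : Ordinal.{u}, (Fin n → Set (RankDomain α)) → (ι → RankDomain α) → Prop) : Prop :=
  ∃ φ : (rankLanguage n).Formula ι, ∀ α X v,
    letI := rankStructure α U X
    φ.Realize v ↔ P α X v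

namespace IsExpressible

open FirstOrder.Language

variable {U : Set ZFSet.{u}} {n : ℕ} {ι : Type}
  {P Q : ∀ α : Ordinal.{u}, (Fin n → Set (RankDomain α)) → (ι → RankDomain α) → Prop}

theorem congr (h : IsExpressible U P) (hPQ : ∀ α X v, Q α X v ↔ P α X v) :
    IsExpressible U Q := by
  obtain ⟨φ, hφ⟩ := h
  exact ⟨φ, fun α X v => (hφ α X v).trans (hPQ α X v).symm⟩

theorem mem (i j : ι) : IsExpressible (n := n) U fun _ _ v => (v i).1 ∈ (v j).1 := by
  refine ⟨Relations.formula (L := rankLanguage n) (n := 2) RankRel.mem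
    ![Term.var i, Term.var j], fun α X v => ?_⟩
  let _ := rankStructure α U X
  exact Formula.realize_rel

theorem pred (i : ι) : IsExpressible (n := n) U fun _ _ v => (v i).1 ∈ U := by
  refine ⟨Relations.formula (L := rankLanguage n) (n := 1) RankRel.pred ![Term.var i],
    fun α X v => ?_⟩
  let _ := rankStructure α U X
  exact Formula.realize_rel

theorem var (m : Fin n) (i : ι) : IsExpressible U fun _ X v => v i ∈ X m := by
  refine ⟨Relations.formula (L := rankLanguage n) (n := 1) (RankRel.var m) ![Term.var i],
    fun α X v => ?_⟩
  let _ := rankStructure α U X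
  exact Formula.realize_rel

theorem eq (i j : ι) : IsExpressible (n := n) U fun _ _ v => v i = v j :=
  ⟨Term.equal (Term.var i) (Term.var j), fun α X v => by
    let _ := rankStructure α U X
    exact Formula.realize_equal⟩

theorem not (h : IsExpressible U P) : IsExpressible U fun α X v => ¬ P α X v := by
  obtain ⟨φ, hφ⟩ := h
  exact ⟨∼φ, fun α X v => by
    let _ := rankStructure α U X
    exact Formula.realize_not.trans (not_congr (hφ α X v))⟩

theorem imp (h : IsExpressible U P) (h' : IsExpressible U Q) :
    IsExpressible U fun α X v => P α X v → Q α X v := by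
  obtain ⟨φ, hφ⟩ := h
  obtain ⟨ψ, hψ⟩ := h'
  exact ⟨φ.imp ψ, fun α X v => by
    let _ := rankStructure α U X
    exact Formula.realize_imp.trans (imp_congr (hφ α X v) (hψ α X v))⟩

theorem and (h : IsExpressible U P) (h' : IsExpressible U Q) :
    IsExpressible U fun α X v => P α X v ∧ Q α X v :=
  (h.imp h'.not).not.congr fun α X v => by tauto

theorem or (h : IsExpressible U P) (h' : IsExpressible U Q) :
    IsExpressible U fun α X v => P α X v ∨ Q α X v :=
  (h.not.imp h').congr fun α X v => by tauto

theorem iff (h : IsExpressible U P) (h' : IsExpressible U Q) :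
    IsExpressible U fun α X v => P α X v ↔ Q α X v :=
  ((h.imp h').and (h'.imp h)).congr fun α X v => by tauto

theorem all {R : ∀ α : Ordinal.{u}, (Fin n → Set (RankDomain α)) → (ι → RankDomain α) →
      RankDomain α → Prop}
    (h : IsExpressible (ι := ι ⊕ Unit) U fun α X w => R α X (fun i => w (.inl i)) (w (.inr ()))) :
    IsExpressible U fun α X v => ∀ x, R α X v x := by
  obtain ⟨φ, hφ⟩ := h
  refine ⟨φ.iAlls Unit, fun α X v => ?_⟩
  let _ := rankStructure α U X
  refine Formula.realize_iAlls.trans ((forall_congr' fun i => hφ α X _).trans ?_)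
  exact ⟨fun h x => h fun _ => x, fun h i => h _⟩

theorem ex {R : ∀ α : Ordinal.{u}, (Fin n → Set (RankDomain α)) → (ι → RankDomain α) →
      RankDomain α → Prop}
    (h : IsExpressible (ι := ι ⊕ Unit) U fun α X w => R α X (fun i => w (.inl i)) (w (.inr ()))) :
    IsExpressible U fun α X v => ∃ x, R α X v x :=
  (all (R := fun α X v x => ¬ R α X v x) h.not).not.congr fun α X v => by simp

end IsExpressible

/-! ### The sentence to be reflected -/

section Formulas

variable {α : Ordinal.{u}}

theorem RankDomain.mem_of_mem {x : ZFSet.{u}} {y : RankDomain α} (h : x ∈ y.1) : x ∈ V_ α :=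
  ZFSet.isTransitive_vonNeumann α _ y.2 h

def IsPair (z x y : RankDomain α) : Prop := z.1 = ZFSet.pair x.1 y.1

/-- The binary relation coded by a set of pairs. -/
def Rel₂ (A : Set (RankDomain α)) (x y : RankDomain α) : Prop := ∃ z, IsPair z x y ∧ z ∈ A

/-- The ternary relation coded by a set of triples. -/
def Rel₃ (A : Set (RankDomain α)) (i x y : RankDomain α) : Prop := ∃ p, IsPair p x y ∧ Rel₂ A i p

/-- The empty set does not belong to `g`. -/
def IsUntagged (g : RankDomain α) : Prop := ∀ e : RankDomain α, e.1 ∈ g.1 →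
  ∃ t : RankDomain α, t.1 ∈ e.1

/-- The transition relation from chart `i` to chart `j` of the coded atlas `F` is a member
of `U`. -/
def HasTransition (U : Set ZFSet.{u}) (F : Set (RankDomain α)) (i j : RankDomain α) : Prop :=
  ∃ g : RankDomain α, g.1 ∈ U ∧ IsUntagged g ∧ ∀ z : RankDomain α, z.1 ∈ g.1 ↔
    ∃ x x' y, IsPair z x x' ∧ Rel₃ F i x y ∧ Rel₃ F j x' y

/-- `F` codes an atlas of a model whose universe consists of the ordinals. -/
def IsCodedAtlas (U : Set ZFSet.{u}) (F : Set (RankDomain α)) : Prop :=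
  (∀ i x y y', Rel₃ F i x y → Rel₃ F i x y' → y = y') ∧
  (∀ i x y, Rel₃ F i x y → y.1.IsOrdinal) ∧
  (∀ y : RankDomain α, y.1.IsOrdinal → ∃ i x, Rel₃ F i x y) ∧
  (∀ i, HasTransition U F i i) ∧
  ∀ i j, ∃ k, HasTransition U F i k ∧ HasTransition U F j k

/-- `H` codes a permutation of the ordinals. -/
def IsCodedPerm (H : Set (RankDomain α)) : Prop :=
  (∀ y : RankDomain α, y.1.IsOrdinal → ∃ y' : RankDomain α, y'.1.IsOrdinal ∧ Rel₂ H y y') ∧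
  (∀ y' : RankDomain α, y'.1.IsOrdinal → ∃ y : RankDomain α, y.1.IsOrdinal ∧ Rel₂ H y y') ∧
  ∀ y y' z z', Rel₂ H y y' → Rel₂ H z z' → (y = z ↔ y' = z')

/-- The relation that `H` induces between chart `i` of `F` and chart `j` of `F'` is, with a tag,
a member of `U`. -/
def HasPartialIso (U : Set ZFSet.{u}) (F F' H : Set (RankDomain α)) (i j : RankDomain α) : Prop :=
  ∃ g : RankDomain α, g.1 ∈ U ∧ ∀ z : RankDomain α, z.1 ∈ g.1 ↔
    (¬ ∃ t : RankDomain α, t.1 ∈ z.1) ∨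
      ∃ x x' y y', IsPair z x x' ∧ Rel₃ F i x y ∧ Rel₃ F' j x' y' ∧ Rel₂ H y y'

/-- No function that is coded by `A` maps an untagged member of `U` onto the ordinals. -/
def IsNotOnto (U : Set ZFSet.{u}) (A : Set (RankDomain α)) : Prop :=
  (∀ x y y', Rel₂ A x y → Rel₂ A x y' → y = y') →
    ∀ g : RankDomain α, g.1 ∈ U → IsUntagged g →
      ∃ y : RankDomain α, y.1.IsOrdinal ∧ ∀ x : RankDomain α, x.1 ∈ g.1 → ¬ Rel₂ A x y

/-- The part of the reflected sentence without second-order quantifiers. -/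
def CategoricityMatrix (α : Ordinal.{u}) (U : Set ZFSet.{u}) (F F' A H : Set (RankDomain α)) :
    Prop :=
  (∀ x y : RankDomain α, ∃ z, IsPair z x y) ∧
  (∃ g : RankDomain α, g.1 ∈ U ∧ IsUntagged g) ∧
  IsNotOnto U A ∧
  (IsCodedAtlas U F → IsCodedAtlas U F' → IsCodedPerm H ∧ ∀ i j, HasPartialIso U F F' H i j)

end Formulas

namespace IsExpressible

variable {U : Set ZFSet.{u}} {n : ℕ} {ι : Type}

/-- `V_α` is transitive, so its members have the same elements inside and outside, and the
Kuratowski definition is absolute. -/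
theorem isPair (i j k : ι) :
    IsExpressible (n := n) U fun _ _ v => IsPair (v i) (v j) (v k) := by
  have h : IsExpressible (n := n) U fun α _ v =>
      (∃ w : RankDomain α, w.1 ∈ (v i).1 ∧ ∀ t : RankDomain α, t.1 ∈ w.1 ↔ t = v j) ∧
      (∃ w : RankDomain α, w.1 ∈ (v i).1 ∧ ∀ t : RankDomain α, t.1 ∈ w.1 ↔ t = v j ∨ t = v k) ∧
      ∀ w : RankDomain α, w.1 ∈ (v i).1 →
        (∀ t : RankDomain α, t.1 ∈ w.1 ↔ t = v j) ∨
          ∀ t : RankDomain α, t.1 ∈ w.1 ↔ t = v j ∨ t = v k := by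
    refine and (ex (and (mem _ _) (all (iff (mem _ _) (eq _ _))))) (and (ex (and (mem _ _)
      (all (iff (mem _ _) (or (eq _ _) (eq _ _)))))) (all (imp (mem _ _) (or
      (all (iff (mem _ _) (eq _ _))) (all (iff (mem _ _) (or (eq _ _) (eq _ _))))))))
  refine h.congr fun α X v => ?_
  have h1 : ∀ w x : RankDomain α, (∀ t : RankDomain α, t.1 ∈ w.1 ↔ t = x) ↔ w.1 = {x.1} := by
    intro w x
    constructor
    · intro hw
      ext t
      rw [ZFSet.mem_singleton]
      constructor
      · intro ht
        exact congrArg Subtype.val ((hw ⟨t, RankDomain.mem_of_mem ht⟩).1 ht)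
      · rintro rfl
        exact (hw x).2 rfl
    · intro hw t
      rw [hw, ZFSet.mem_singleton, Subtype.ext_iff]
  have h2 : ∀ w x y : RankDomain α,
      (∀ t : RankDomain α, t.1 ∈ w.1 ↔ t = x ∨ t = y) ↔ w.1 = {x.1, y.1} := by
    intro w x y
    constructor
    · intro hw
      ext t
      rw [ZFSet.mem_pair]
      constructor
      · intro ht
        exact ((hw ⟨t, RankDomain.mem_of_mem ht⟩).1 ht).imp (congrArg Subtype.val)
          (congrArg Subtype.val)
      · rintro (rfl | rfl)
        · exact (hw x).2 (Or.inl rfl)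
        · exact (hw y).2 (Or.inr rfl)
    · intro hw t
      rw [hw, ZFSet.mem_pair, Subtype.ext_iff, Subtype.ext_iff]
  simp only [h1, h2, IsPair, ZFSet.pair]
  constructor
  · intro hz
    have hs : ({(v j).1} : ZFSet) ∈ (v i).1 := by simp [hz]
    have hp : ({(v j).1, (v k).1} : ZFSet) ∈ (v i).1 := by simp [hz]
    refine ⟨⟨⟨_, RankDomain.mem_of_mem hs⟩, hs, rfl⟩, ⟨⟨_, RankDomain.mem_of_mem hp⟩, hp, rfl⟩,
      fun w hw => ?_⟩
    rwa [hz, ZFSet.mem_pair] at hw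
  · rintro ⟨⟨w, hw, hw'⟩, ⟨w', hw'', hw'''⟩, hall⟩
    ext t
    rw [ZFSet.mem_pair]
    constructor
    · intro ht
      exact hall ⟨t, RankDomain.mem_of_mem ht⟩ ht
    · rintro (rfl | rfl)
      · rwa [← hw']
      · rwa [← hw''']

theorem rel₂ (m : Fin n) (i j : ι) : IsExpressible U fun _ X v => Rel₂ (X m) (v i) (v j) :=
  ex (and (isPair _ _ _) (var _ _))

theorem rel₃ (m : Fin n) (i j k : ι) :
    IsExpressible U fun _ X v => Rel₃ (X m) (v i) (v j) (v k) :=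
  ex (and (isPair _ _ _) (rel₂ _ _ _))

theorem isOrdinal (i : ι) : IsExpressible (n := n) U fun _ _ v => (v i).1.IsOrdinal := by
  have h : IsExpressible (n := n) U fun α _ v =>
      (∀ y : RankDomain α, y.1 ∈ (v i).1 → ∀ z : RankDomain α, z.1 ∈ y.1 → z.1 ∈ (v i).1) ∧
      ∀ x y z : RankDomain α, x.1 ∈ y.1 → y.1 ∈ z.1 → z.1 ∈ (v i).1 → x.1 ∈ z.1 :=
    and (all (imp (mem _ _) (all (imp (mem _ _) (mem _ _)))))
      (all (all (all (imp (mem _ _) (imp (mem _ _) (imp (mem _ _) (mem _ _)))))))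
  refine h.congr fun α X v => ?_
  constructor
  · intro h
    exact ⟨fun y hy z hz => h.isTransitive _ hy hz,
      fun x y z hxy hyz hz => h.mem_trans' hxy hyz hz⟩
  · rintro ⟨h, h'⟩
    refine ⟨fun y hy z hz => ?_, fun {x y z} hxy hyz hz => ?_⟩
    · have hy' := RankDomain.mem_of_mem hy
      exact h ⟨y, hy'⟩ hy ⟨z, RankDomain.mem_of_mem (y := ⟨y, hy'⟩) hz⟩ hz
    · have hz' := RankDomain.mem_of_mem hz
      have hy' := RankDomain.mem_of_mem (y := ⟨z, hz'⟩) hyz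
      exact h' ⟨x, RankDomain.mem_of_mem (y := ⟨y, hy'⟩) hxy⟩ ⟨y, hy'⟩ ⟨z, hz'⟩ hxy hyz hz

theorem isUntagged (i : ι) : IsExpressible (n := n) U fun _ _ v => IsUntagged (v i) :=
  all (imp (mem _ _) (ex (mem _ _)))

theorem hasTransition (m : Fin n) (i j : ι) :
    IsExpressible U fun _ X v => HasTransition U (X m) (v i) (v j) :=
  ex (and (pred _) (and (isUntagged _) (all (iff (mem _ _) (ex (ex (ex (and (isPair _ _ _)
    (and (rel₃ _ _ _ _) (rel₃ _ _ _ _))))))))))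

theorem isCodedAtlas (m : Fin n) :
    IsExpressible (ι := ι) U fun _ X _ => IsCodedAtlas U (X m) :=
  and (all (all (all (all (imp (rel₃ _ _ _ _) (imp (rel₃ _ _ _ _) (eq _ _)))))))
    (and (all (all (all (imp (rel₃ _ _ _ _) (isOrdinal _)))))
      (and (all (imp (isOrdinal _) (ex (ex (rel₃ _ _ _ _)))))
        (and (all (hasTransition _ _ _))
          (all (all (ex (and (hasTransition _ _ _) (hasTransition _ _ _))))))))

theorem isCodedPerm (m : Fin n) : IsExpressible (ι := ι) U fun _ X _ => IsCodedPerm (X m) :=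
  and (all (imp (isOrdinal _) (ex (and (isOrdinal _) (rel₂ _ _ _)))))
    (and (all (imp (isOrdinal _) (ex (and (isOrdinal _) (rel₂ _ _ _)))))
      (all (all (all (all (imp (rel₂ _ _ _) (imp (rel₂ _ _ _) (iff (eq _ _) (eq _ _)))))))))

theorem hasPartialIso (m m' h : Fin n) (i j : ι) :
    IsExpressible U fun _ X v => HasPartialIso U (X m) (X m') (X h) (v i) (v j) :=
  ex (and (pred _) (all (iff (mem _ _) (or (not (ex (mem _ _))) (ex (ex (ex (ex
    (and (isPair _ _ _) (and (rel₃ _ _ _ _) (and (rel₃ _ _ _ _) (rel₂ _ _ _))))))))))))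

theorem isNotOnto (m : Fin n) : IsExpressible (ι := ι) U fun _ X _ => IsNotOnto U (X m) :=
  imp (all (all (all (imp (rel₂ _ _ _) (imp (rel₂ _ _ _) (eq _ _))))))
    (all (imp (pred _) (imp (isUntagged _) (ex (and (isOrdinal _)
      (all (imp (mem _ _) (not (rel₂ _ _ _)))))))))

theorem categoricityMatrix (m₀ m₁ m₂ m₃ : Fin n) :
    IsExpressible (ι := ι) U fun α X _ => CategoricityMatrix α U (X m₀) (X m₁) (X m₂) (X m₃) :=
  and (all (all (ex (isPair _ _ _)))) (and (ex (and (pred _) (isUntagged _)))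
    (and (isNotOnto _) (imp (isCodedAtlas _) (imp (isCodedAtlas _)
      (and (isCodedPerm _) (all (all (hasPartialIso _ _ _ _ _))))))))

end IsExpressible

/-- `Π¹₂`-indescribability reflects `∀ F F' A ∃ H, CategoricityMatrix α U F F' A H`. -/
theorem IsPiOneTwoIndescribable.reflect {κ : Cardinal.{u}} (hκ : IsPiOneTwoIndescribable κ)
    {U : Set ZFSet.{u}} (hU : ∀ x ∈ U, x ∈ V_ κ.ord)
    (h : ∀ F F' A, ∃ H, CategoricityMatrix κ.ord U F F' A H) :
    ∃ α < κ.ord, ∀ F F' A, ∃ H, CategoricityMatrix α U F F' A H := by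
  obtain ⟨φ, hφ⟩ := IsExpressible.categoricityMatrix (n := 3 + 1) (ι := Empty) (U := U) 0 1 2 3
  have key : ∀ α, PiOneTwoSentence.Holds ⟨3, 1, φ⟩ α U ↔
      ∀ F F' A, ∃ H, CategoricityMatrix α U F F' A H := by
    intro α
    constructor
    · intro h F F' A
      obtain ⟨Y, hY⟩ := h ![F, F', A]
      exact ⟨Y 0, (hφ _ _ _).1 hY⟩
    · intro h X
      obtain ⟨H, hH⟩ := h (X 0) (X 1) (X 2)
      exact ⟨fun _ => H, (hφ _ _ _).2 hH⟩
  obtain ⟨α, hα, h'⟩ := hκ U hU _ ((key _).2 h)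
  exact ⟨α, hα, (key α).1 h'⟩

/-! ### Pairs, ordinals and coded relations in V_α -/

section RankDomain

variable {α : Ordinal.{u}}

theorem ZFSet.rank_kuratowski_lt {x y : ZFSet.{u}} {β : Ordinal.{u}} (hx : x.rank < β)
    (hy : y.rank < β) : (ZFSet.pair x y).rank < Order.succ (Order.succ β) := by
  have hx' := Order.succ_le_of_lt hx
  have hy' := Order.succ_le_of_lt hy
  rw [ZFSet.pair, ZFSet.rank_pair, ZFSet.rank_pair, ZFSet.rank_singleton, Order.lt_succ_iff,
    max_le_iff, Order.succ_le_succ_iff, Order.succ_le_succ_iff]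
  exact ⟨hx', max_le hx' hy'⟩

theorem ZFSet.pair_ne_empty (x y : ZFSet.{u}) : ZFSet.pair x y ≠ ∅ := by
  intro h
  have : ({x} : ZFSet) ∈ ZFSet.pair x y := by simp [ZFSet.pair]
  rw [h] at this
  exact ZFSet.notMem_empty _ this

theorem exists_isPair (hα : Order.IsSuccLimit α) (x y : RankDomain α) : ∃ z, IsPair z x y := by
  have hx := ZFSet.mem_vonNeumann.1 x.2
  have hy := ZFSet.mem_vonNeumann.1 y.2
  refine ⟨⟨ZFSet.pair x.1 y.1, ZFSet.mem_vonNeumann.2 ?_⟩, rfl⟩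
  refine (ZFSet.rank_kuratowski_lt (β := Order.succ (max x.1.rank y.1.rank)) ?_ ?_).trans
    (hα.succ_lt (hα.succ_lt (hα.succ_lt (max_lt hx hy))))
  · exact Order.lt_succ_of_le (le_max_left _ _)
  · exact Order.lt_succ_of_le (le_max_right _ _)

/-- If `α = a + 1`, then `a ∈ V_α`, but the pair `(a, a)` has rank `a + 2`. The point `g` excludes
`α = 0`. -/
theorem isSuccLimit_of_exists_isPair (g : RankDomain α)
    (h : ∀ x y : RankDomain α, ∃ z, IsPair z x y) : Order.IsSuccLimit α := by
  refine ⟨not_isMin_of_lt (ZFSet.mem_vonNeumann.1 g.2), ?_⟩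
  refine Order.isSuccPrelimit_of_succ_ne fun a ha => ?_
  have hlt : a < α := ha ▸ Order.lt_succ a
  have hmem : a.toZFSet ∈ V_ α := ZFSet.mem_vonNeumann.2 (by rwa [Ordinal.rank_toZFSet])
  obtain ⟨z, hz⟩ := h ⟨_, hmem⟩ ⟨_, hmem⟩
  have hz' := ZFSet.mem_vonNeumann.1 z.2
  rw [show z.1 = _ from hz, ZFSet.pair, ZFSet.rank_pair, ZFSet.rank_singleton,
    Ordinal.rank_toZFSet] at hz'
  have := (le_max_left _ _).trans_lt hz'
  rw [ha] at this
  exact absurd (Order.lt_succ α) this.not_gt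

/-- The elements of `α`, as members of `V_α`. -/
noncomputable def ordPoint (y : α.ToType) : RankDomain α :=
  ⟨y.toOrd.1.toZFSet, ZFSet.mem_vonNeumann.2 (by rw [Ordinal.rank_toZFSet]; exact y.toOrd.2)⟩

theorem ordPoint_injective : Function.Injective (ordPoint (α := α)) := fun _ _ h =>
  Ordinal.ToType.mk.symm.injective
    (Subtype.ext (Ordinal.toZFSet_injective (congrArg Subtype.val h)))

theorem isOrdinal_ordPoint (y : α.ToType) : (ordPoint y).1.IsOrdinal :=
  ZFSet.isOrdinal_toZFSet _

theorem exists_ordPoint {x : RankDomain α} (h : x.1.IsOrdinal) : ∃ y, ordPoint y = x := by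
  refine ⟨Ordinal.ToType.mk ⟨x.1.rank, ZFSet.mem_vonNeumann.1 x.2⟩, Subtype.ext ?_⟩
  simp only [ordPoint, Ordinal.ToType.toOrd, OrderIso.symm_apply_apply]
  exact h.toZFSet_rank_eq

theorem exists_rel₂ (hα : Order.IsSuccLimit α) (r : RankDomain α → RankDomain α → Prop) :
    ∃ A, ∀ x y, Rel₂ A x y ↔ r x y := by
  refine ⟨{z | ∃ x y, IsPair z x y ∧ r x y}, fun x y => ⟨?_, fun h => ?_⟩⟩
  · rintro ⟨z, hz, x', y', hz', h⟩
    obtain ⟨h1, h2⟩ := ZFSet.pair_inj.1 (hz.symm.trans hz')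
    rwa [Subtype.ext h1, Subtype.ext h2]
  · obtain ⟨z, hz⟩ := exists_isPair hα x y
    exact ⟨z, hz, x, y, hz, h⟩

theorem exists_rel₃ (hα : Order.IsSuccLimit α)
    (r : RankDomain α → RankDomain α → RankDomain α → Prop) :
    ∃ A, ∀ i x y, Rel₃ A i x y ↔ r i x y := by
  obtain ⟨A, hA⟩ := exists_rel₂ hα fun i p => ∃ x y, IsPair p x y ∧ r i x y
  refine ⟨A, fun i x y => ⟨?_, fun h => ?_⟩⟩
  · rintro ⟨p, hp, h⟩
    obtain ⟨x', y', hp', h⟩ := (hA _ _).1 h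
    obtain ⟨h1, h2⟩ := ZFSet.pair_inj.1 (hp.symm.trans hp')
    rwa [Subtype.ext h1, Subtype.ext h2]
  · obtain ⟨p, hp⟩ := exists_isPair hα x y
    exact ⟨p, hp, (hA _ _).2 ⟨x, y, hp, h⟩⟩

theorem isUntagged_iff {g : RankDomain α} : IsUntagged g ↔ ∅ ∉ g.1 := by
  constructor
  · intro h hg
    obtain ⟨t, ht⟩ := h ⟨∅, RankDomain.mem_of_mem hg⟩ hg
    exact ZFSet.notMem_empty _ ht
  · intro h e he
    rcases ZFSet.eq_empty_or_nonempty e.1 with h0 | ⟨t, ht⟩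
    · exact absurd (h0 ▸ he) h
    · exact ⟨⟨t, RankDomain.mem_of_mem ht⟩, ht⟩

end RankDomain

/-! ### Coding atlases by subsets of V_α -/

namespace AEC

variable {L : FirstOrder.Language.{u, u}} (K : AEC L) {X : Type u}
  (δ : L.Structure X × X → ZFSet.{u})

/-- The graph of a map from the structure `s` to the structure `t`. -/
noncomputable def embGraph (s t : L.Structure X) (e : X → X) : ZFSet.{u} :=
  ZFSet.range fun x : X => ZFSet.pair (δ (s, x)) (δ (t, e x))

/-- The graph of a relation between the structures `s` and `t`, with the tag `∅`. -/
noncomputable def relGraph (s t : L.Structure X) (r : X → X → Prop) : ZFSet.{u} :=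
  insert ∅ (ZFSet.range fun p : {p : X × X // r p.1 p.2} =>
    ZFSet.pair (δ (s, p.1.1)) (δ (t, p.1.2)))

/-- The codes of all strong embeddings and of all partial isomorphisms between structures
on `X`. -/
def transitionCodes : Set ZFSet.{u} :=
  {g | ∃ s t e, IsStrongEmb K s t e ∧ g = embGraph δ s t e} ∪
    {g | ∃ s t r, IsPartialIso s t r ∧ g = relGraph δ s t r}

/-- `F` codes the charts `s i`, `f i`. -/
def IsCode {α : Ordinal.{u}} (F : Set (RankDomain α)) (s : RankDomain α → L.Structure X)
    (f : RankDomain α → X → α.ToType) : Prop :=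
  ∀ i x y, Rel₃ F i x y ↔ ∃ ξ, x.1 = δ (s i, ξ) ∧ y = ordPoint (f i ξ)

variable {K δ} {α β : Ordinal.{u}}

theorem mem_embGraph {s t : L.Structure X} {e : X → X} {z : ZFSet.{u}} :
    z ∈ embGraph δ s t e ↔ ∃ x, ZFSet.pair (δ (s, x)) (δ (t, e x)) = z := by
  simp [embGraph]

theorem mem_relGraph {s t : L.Structure X} {r : X → X → Prop} {z : ZFSet.{u}} :
    z ∈ relGraph δ s t r ↔ z = ∅ ∨ ∃ x y, r x y ∧ z = ZFSet.pair (δ (s, x)) (δ (t, y)) := by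
  rw [relGraph, ZFSet.mem_insert_iff, ZFSet.mem_range]
  refine or_congr_right ⟨?_, ?_⟩
  · rintro ⟨⟨p, hp⟩, rfl⟩
    exact ⟨_, _, hp, rfl⟩
  · rintro ⟨x, y, h, rfl⟩
    exact ⟨⟨(x, y), h⟩, rfl⟩

theorem eq_of_code_eq (hδ : Function.Injective δ) {s t : L.Structure X} {x y : X}
    (h : δ (s, x) = δ (t, y)) : s = t ∧ x = y :=
  Prod.ext_iff.1 (hδ h)

theorem pair_mem_embGraph (hδ : Function.Injective δ) {s t s' t' : L.Structure X} {e : X → X}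
    {x y : X} : ZFSet.pair (δ (s', x)) (δ (t', y)) ∈ embGraph δ s t e ↔
      s' = s ∧ t' = t ∧ y = e x := by
  rw [mem_embGraph]
  constructor
  · rintro ⟨z, hz⟩
    obtain ⟨h1, h2⟩ := ZFSet.pair_inj.1 hz
    obtain ⟨rfl, rfl⟩ := eq_of_code_eq hδ h1
    obtain ⟨rfl, rfl⟩ := eq_of_code_eq hδ h2
    exact ⟨rfl, rfl, rfl⟩
  · rintro ⟨rfl, rfl, rfl⟩
    exact ⟨x, rfl⟩

theorem pair_mem_relGraph (hδ : Function.Injective δ) {s t s' t' : L.Structure X}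
    {r : X → X → Prop} {x y : X} : ZFSet.pair (δ (s', x)) (δ (t', y)) ∈ relGraph δ s t r ↔
      s' = s ∧ t' = t ∧ r x y := by
  rw [mem_relGraph]
  constructor
  · rintro (h | ⟨x', y', hr, hz⟩)
    · exact absurd h (ZFSet.pair_ne_empty _ _)
    · obtain ⟨h1, h2⟩ := ZFSet.pair_inj.1 hz
      obtain ⟨rfl, rfl⟩ := eq_of_code_eq hδ h1
      obtain ⟨rfl, rfl⟩ := eq_of_code_eq hδ h2
      exact ⟨rfl, rfl, hr⟩
  · rintro ⟨rfl, rfl, hr⟩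
    exact Or.inr ⟨x, y, hr, rfl⟩

theorem empty_notMem_embGraph {s t : L.Structure X} {e : X → X} : ∅ ∉ embGraph δ s t e := by
  rw [mem_embGraph]
  rintro ⟨x, hx⟩
  exact ZFSet.pair_ne_empty _ _ hx

theorem exists_embGraph_of_isUntagged {g : RankDomain α} (hg : g.1 ∈ transitionCodes K δ)
    (hg' : IsUntagged g) : ∃ s t e, IsStrongEmb K s t e ∧ g.1 = embGraph δ s t e := by
  rcases hg with hg | ⟨s, t, r, -, h⟩
  · exact hg
  · exact absurd (h ▸ mem_relGraph.2 (Or.inl rfl)) (isUntagged_iff.1 hg')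

theorem mem_vonNeumann_of_mem_transitionCodes (hα : Order.IsSuccLimit α) (hβ : β < α)
    (hδβ : ∀ p, (δ p).rank < β) {g : ZFSet.{u}} (hg : g ∈ transitionCodes K δ) : g ∈ V_ α := by
  refine ZFSet.mem_vonNeumann.2 (lt_of_le_of_lt (ZFSet.rank_le_iff.2 fun z hz => ?_)
    (hα.succ_lt (hα.succ_lt hβ)))
  rcases hg with ⟨s, t, e, -, rfl⟩ | ⟨s, t, r, -, rfl⟩
  · obtain ⟨x, rfl⟩ := mem_embGraph.1 hz
    exact ZFSet.rank_kuratowski_lt (hδβ _) (hδβ _)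
  · obtain rfl | ⟨x, y, -, rfl⟩ := mem_relGraph.1 hz
    · rw [ZFSet.rank_empty]
      exact bot_le.trans_lt (Order.lt_succ _)
    · exact ZFSet.rank_kuratowski_lt (hδβ _) (hδβ _)

/-- The member `δ p` of `V_α`. -/
def chartPoint (hβ : β < α) (hδβ : ∀ p, (δ p).rank < β) (p : L.Structure X × X) : RankDomain α :=
  ⟨δ p, ZFSet.mem_vonNeumann.2 ((hδβ p).trans hβ)⟩

/-- An untagged code is the graph of a map on `X`, so it has at most `#X` members. -/
theorem isNotOnto_of_card_lt (hX : #X < α.card) (A : Set (RankDomain α)) :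
    IsNotOnto (transitionCodes K δ) A := by
  intro hA g hg hg'
  by_contra! hcon
  obtain ⟨s, t, e, -, hgr⟩ := exists_embGraph_of_isUntagged hg hg'
  have h : ∀ o : α.ToType, ∃ (ξ : X) (x : RankDomain α),
      ZFSet.pair (δ (s, ξ)) (δ (t, e ξ)) = x.1 ∧ Rel₂ A x (ordPoint o) := by
    intro o
    obtain ⟨x, hx, hx'⟩ := hcon (ordPoint o) (isOrdinal_ordPoint o)
    rw [hgr, mem_embGraph] at hx
    obtain ⟨ξ, hξ⟩ := hx
    exact ⟨ξ, x, hξ, hx'⟩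
  choose ξ x hx hx' using h
  refine hX.not_ge ?_
  rw [← Cardinal.mk_toType]
  refine Cardinal.mk_le_of_injective (f := ξ) fun o o' hoo => ?_
  have hxx : x o = x o' := Subtype.ext (by rw [← hx, ← hx, hoo])
  exact ordPoint_injective (hA _ _ _ (hx' o) (hxx ▸ hx' o'))

/-- Otherwise `α` injects into `X`, and inverting this injection along the pairs in the graph `g`
gives a coded map onto `α`. -/
theorem card_lt_of_isNotOnto (hδ : Function.Injective δ) (hα : Order.IsSuccLimit α)
    (h : ∀ A : Set (RankDomain α), IsNotOnto (transitionCodes K δ) A) {g : RankDomain α}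
    (hg : g.1 ∈ transitionCodes K δ) (hg' : IsUntagged g) : #X < α.card := by
  by_contra! hcon
  obtain ⟨s, t, e, -, hgr⟩ := exists_embGraph_of_isUntagged hg hg'
  rw [← Cardinal.mk_toType, Cardinal.le_def] at hcon
  obtain ⟨j⟩ := hcon
  obtain ⟨A, hA⟩ := exists_rel₂ hα fun x y => ∃ o : α.ToType,
    x.1 = ZFSet.pair (δ (s, j o)) (δ (t, e (j o))) ∧ y = ordPoint o
  obtain ⟨y, hy, hy'⟩ := h A (fun x y y' hy hy' => by
    obtain ⟨o, ho, rfl⟩ := (hA _ _).1 hy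
    obtain ⟨o', ho', rfl⟩ := (hA _ _).1 hy'
    have h1 := (eq_of_code_eq hδ (ZFSet.pair_inj.1 (ho.symm.trans ho')).1).2
    rw [j.injective h1]) g hg hg'
  obtain ⟨o, rfl⟩ := exists_ordPoint hy
  have hmem : ZFSet.pair (δ (s, j o)) (δ (t, e (j o))) ∈ g.1 := by
    rw [hgr, mem_embGraph]
    exact ⟨_, rfl⟩
  exact hy' ⟨_, RankDomain.mem_of_mem hmem⟩ hmem ((hA _ _).2 ⟨o, rfl, rfl⟩)

section Coding

variable {F F' H : Set (RankDomain α)} {s s' : RankDomain α → L.Structure X}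
  {f f' : RankDomain α → X → α.ToType}

theorem IsCode.hasTransition (hα : Order.IsSuccLimit α) (hβ : β < α)
    (hδβ : ∀ p, (δ p).rank < β) (hF : IsCode δ F s f) {i j : RankDomain α}
    (hinj : Function.Injective (f j)) {e : X → X} (he : IsStrongEmb K (s i) (s j) e)
    (h : ∀ ξ, f j (e ξ) = f i ξ) : HasTransition (transitionCodes K δ) F i j := by
  have hmem : embGraph δ (s i) (s j) e ∈ transitionCodes K δ := Or.inl ⟨_, _, _, he, rfl⟩
  refine ⟨⟨_, mem_vonNeumann_of_mem_transitionCodes hα hβ hδβ hmem⟩, hmem,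
    isUntagged_iff.2 empty_notMem_embGraph, fun z => ?_⟩
  rw [mem_embGraph]
  constructor
  · rintro ⟨ξ, hξ⟩
    exact ⟨chartPoint hβ hδβ (s i, ξ), chartPoint hβ hδβ (s j, e ξ), ordPoint (f i ξ), hξ.symm,
      (hF _ _ _).2 ⟨ξ, rfl, rfl⟩, (hF _ _ _).2 ⟨e ξ, rfl, by rw [h]⟩⟩
  · rintro ⟨x, x', y, hz, h1, h2⟩
    obtain ⟨ξ, hx, rfl⟩ := (hF _ _ _).1 h1
    obtain ⟨ξ', hx', hy⟩ := (hF _ _ _).1 h2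
    have : ξ' = e ξ := hinj (by rw [h, ordPoint_injective hy])
    exact ⟨ξ, by rw [hz, hx, hx', this]⟩

/-- `δ` codes a point together with its structure, so for nonempty `X` a graph determines its
source, its target and the map. -/
theorem IsCode.exists_of_hasTransition [Nonempty X] (hδ : Function.Injective δ)
    (hF : IsCode δ F s f)
    {i j : RankDomain α} (h : HasTransition (transitionCodes K δ) F i j) :
    ∃ e, IsStrongEmb K (s i) (s j) e ∧ ∀ ξ, f j (e ξ) = f i ξ := by
  obtain ⟨g, hg, hg', hgz⟩ := h
  obtain ⟨S, T, e, he, hgr⟩ := exists_embGraph_of_isUntagged hg hg'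
  have key : ∀ ξ, S = s i ∧ T = s j ∧ f j (e ξ) = f i ξ := by
    intro ξ
    have hmem : ZFSet.pair (δ (S, ξ)) (δ (T, e ξ)) ∈ g.1 := by
      rw [hgr, mem_embGraph]
      exact ⟨_, rfl⟩
    obtain ⟨x, x', y, hz, h1, h2⟩ := (hgz ⟨_, RankDomain.mem_of_mem hmem⟩).1 hmem
    obtain ⟨ξ₁, hx, rfl⟩ := (hF _ _ _).1 h1
    obtain ⟨ξ₂, hx', hy⟩ := (hF _ _ _).1 h2
    obtain ⟨h3, h4⟩ := ZFSet.pair_inj.1 hz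
    obtain ⟨h5, rfl⟩ := eq_of_code_eq hδ (h3.trans hx)
    obtain ⟨h6, h7⟩ := eq_of_code_eq hδ (h4.trans hx')
    exact ⟨h5, h6, by rw [h7, ordPoint_injective hy]⟩
  obtain ⟨rfl, rfl, -⟩ := key (Classical.arbitrary X)
  exact ⟨e, he, fun ξ => (key ξ).2.2⟩

/-- The transition from `i` to itself relates codes with equal image and is the graph of a map `e`.
Symmetry gives `s = t`, and reflexivity then gives that `e` is the identity; hence the chart is an
injection defined exactly on the codes of points of `s`. -/
theorem _root_.IsCodedAtlas.exists_chart (hδ : Function.Injective δ) (hα : Order.IsSuccLimit α)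
    (hβ : β < α) (hδβ : ∀ p, (δ p).rank < β) (hF : IsCodedAtlas (transitionCodes K δ) F)
    [Nonempty X] (i : RankDomain α) : ∃ (s : L.Structure X) (f : X → α.ToType),
      Function.Injective f ∧
        ∀ x y, Rel₃ F i x y ↔ ∃ ξ, x.1 = δ (s, ξ) ∧ y = ordPoint (f ξ) := by
  obtain ⟨hfun, hord, -, hrefl, -⟩ := hF
  obtain ⟨g, hg, hg', hgz⟩ := hrefl i
  obtain ⟨s, t, e, -, hgr⟩ := exists_embGraph_of_isUntagged hg hg'
  have hpair : ∀ x x' y, Rel₃ F i x y → Rel₃ F i x' y → ZFSet.pair x.1 x'.1 ∈ g.1 := by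
    intro x x' y h h'
    obtain ⟨z, hz⟩ := exists_isPair hα x x'
    rw [← show z.1 = _ from hz]
    exact (hgz z).2 ⟨x, x', y, hz, h, h'⟩
  have hrel : ∀ ξ, ∃ y, Rel₃ F i (chartPoint hβ hδβ (s, ξ)) y ∧
      Rel₃ F i (chartPoint hβ hδβ (t, e ξ)) y := by
    intro ξ
    have hmem : ZFSet.pair (δ (s, ξ)) (δ (t, e ξ)) ∈ g.1 := by
      rw [hgr, mem_embGraph]
      exact ⟨_, rfl⟩
    obtain ⟨x, x', y, hz, h1, h2⟩ := (hgz ⟨_, RankDomain.mem_of_mem hmem⟩).1 hmem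
    obtain ⟨h3, h4⟩ := ZFSet.pair_inj.1 hz
    rw [show x = chartPoint hβ hδβ (s, ξ) from Subtype.ext h3.symm] at h1
    rw [show x' = chartPoint hβ hδβ (t, e ξ) from Subtype.ext h4.symm] at h2
    exact ⟨y, h1, h2⟩
  choose y hy hy' using hrel
  have hst : s = t := by
    have h := hpair _ _ _ (hy' (Classical.arbitrary X)) (hy (Classical.arbitrary X))
    rw [hgr] at h
    exact ((pair_mem_embGraph hδ).1 h).1.symm
  subst hst
  have he : ∀ ξ, ξ = e ξ := by
    intro ξ
    have h := hpair _ _ _ (hy ξ) (hy ξ)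
    rw [hgr] at h
    exact ((pair_mem_embGraph hδ).1 h).2.2
  choose f hf using fun ξ => exists_ordPoint (hord _ _ _ (hy ξ))
  refine ⟨s, f, fun ξ ξ' hξ => ?_, fun x z => ⟨fun h => ?_, ?_⟩⟩
  · have hyy : y ξ' = y ξ := by rw [← hf, ← hf, hξ]
    have h := hpair _ _ _ (hy ξ) (hyy ▸ hy ξ')
    rw [hgr] at h
    rw [he ξ]
    exact ((pair_mem_embGraph hδ).1 h).2.2.symm
  · have hx := hpair x x z h h
    rw [hgr, mem_embGraph] at hx
    obtain ⟨ξ, hξ⟩ := hx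
    have hx : x = chartPoint hβ hδβ (s, ξ) := Subtype.ext (ZFSet.pair_inj.1 hξ).1.symm
    subst hx
    exact ⟨ξ, rfl, (hfun _ _ _ _ h (hy ξ)).trans (hf ξ).symm⟩
  · rintro ⟨ξ, hx, rfl⟩
    rw [show x = chartPoint hβ hδβ (s, ξ) from Subtype.ext hx, hf]
    exact hy ξ

theorem _root_.IsCodedAtlas.exists_isAtlas (hδ : Function.Injective δ) (hα : Order.IsSuccLimit α)
    (hβ : β < α) (hδβ : ∀ p, (δ p).rank < β) (hF : IsCodedAtlas (transitionCodes K δ) F)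
    [Nonempty X] : ∃ (s : RankDomain α → L.Structure X) (f : RankDomain α → X → α.ToType),
      IsAtlas K s f ∧ IsCode δ F s f := by
  choose s f hinj hcode using hF.exists_chart hδ hα hβ hδβ
  have hcode : IsCode δ F s f := hcode
  refine ⟨s, f, ⟨hinj, fun y => ?_, fun i j => ?_⟩, hcode⟩
  · obtain ⟨i, x, h⟩ := hF.2.2.1 (ordPoint y) (isOrdinal_ordPoint y)
    obtain ⟨ξ, -, hy⟩ := (hcode _ _ _).1 h
    exact ⟨i, ξ, (ordPoint_injective hy).symm⟩
  · obtain ⟨k, hk, hk'⟩ := hF.2.2.2.2 i j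
    exact ⟨k, hcode.exists_of_hasTransition hδ hk,
      hcode.exists_of_hasTransition hδ hk'⟩

theorem IsAtlas.exists_isCodedAtlas (hδ : Function.Injective δ) (hα : Order.IsSuccLimit α)
    (hβ : β < α) (hδβ : ∀ p, (δ p).rank < β) (h : IsAtlas K s f)
    (hs : ∀ i, IsStrongEmb K (s i) (s i) id) :
    ∃ F, IsCodedAtlas (transitionCodes K δ) F ∧ IsCode δ F s f := by
  obtain ⟨F, hF⟩ := exists_rel₃ hα fun i x y => ∃ ξ, x.1 = δ (s i, ξ) ∧ y = ordPoint (f i ξ)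
  have hF : IsCode δ F s f := hF
  refine ⟨F, ⟨?_, ?_, ?_, ?_, ?_⟩, hF⟩
  · intro i x y y' hy hy'
    obtain ⟨ξ, hx, rfl⟩ := (hF _ _ _).1 hy
    obtain ⟨ξ', hx', rfl⟩ := (hF _ _ _).1 hy'
    rw [(eq_of_code_eq hδ (hx.symm.trans hx')).2]
  · intro i x y hy
    obtain ⟨ξ, -, rfl⟩ := (hF _ _ _).1 hy
    exact isOrdinal_ordPoint _
  · intro y hy
    obtain ⟨o, rfl⟩ := exists_ordPoint hy
    obtain ⟨i, ξ, rfl⟩ := h.cover o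
    exact ⟨i, chartPoint hβ hδβ (s i, ξ), (hF _ _ _).2 ⟨ξ, rfl, rfl⟩⟩
  · exact fun i => hF.hasTransition hα hβ hδβ (h.inj i) (hs i) fun _ => rfl
  · intro i j
    obtain ⟨k, ⟨d, hd, hd'⟩, e, he, he'⟩ := h.directed i j
    exact ⟨k, hF.hasTransition hα hβ hδβ (h.inj k) hd hd',
      hF.hasTransition hα hβ hδβ (h.inj k) he he'⟩

variable {h : α.ToType ≃ α.ToType}

theorem IsCode.rel_iff (hβ : β < α) (hδβ : ∀ p, (δ p).rank < β) (hF : IsCode δ F s f)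
    (hF' : IsCode δ F' s' f') (hH : ∀ o o', Rel₂ H (ordPoint o) (ordPoint o') ↔ h o = o')
    (i j z : RankDomain α) :
    (∃ x x' y y', IsPair z x x' ∧ Rel₃ F i x y ∧ Rel₃ F' j x' y' ∧ Rel₂ H y y') ↔
      ∃ ξ ξ', h (f i ξ) = f' j ξ' ∧ z.1 = ZFSet.pair (δ (s i, ξ)) (δ (s' j, ξ')) := by
  constructor
  · rintro ⟨x, x', y, y', hz, h1, h2, h3⟩
    obtain ⟨ξ, hx, rfl⟩ := (hF _ _ _).1 h1
    obtain ⟨ξ', hx', rfl⟩ := (hF' _ _ _).1 h2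
    exact ⟨ξ, ξ', (hH _ _).1 h3, by rw [← hx, ← hx']; exact hz⟩
  · rintro ⟨ξ, ξ', h1, hz⟩
    exact ⟨chartPoint hβ hδβ (s i, ξ), chartPoint hβ hδβ (s' j, ξ'), _, _, hz,
      (hF _ _ _).2 ⟨ξ, rfl, rfl⟩, (hF' _ _ _).2 ⟨ξ', rfl, rfl⟩, (hH _ _).2 h1⟩

theorem not_exists_mem_iff {z : RankDomain α} : (¬ ∃ t : RankDomain α, t.1 ∈ z.1) ↔ z.1 = ∅ := by
  rw [ZFSet.eq_empty, not_exists]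
  exact ⟨fun h t ht => h ⟨t, RankDomain.mem_of_mem ht⟩ ht, fun h t => h _⟩

theorem IsCode.hasPartialIso (hα : Order.IsSuccLimit α) (hβ : β < α)
    (hδβ : ∀ p, (δ p).rank < β) (hF : IsCode δ F s f)
    (hF' : IsCode δ F' s' f') (hH : ∀ o o', Rel₂ H (ordPoint o) (ordPoint o') ↔ h o = o')
    {i j : RankDomain α} (hij : IsPartialIso (s i) (s' j) fun ξ ξ' => h (f i ξ) = f' j ξ') :
    HasPartialIso (transitionCodes K δ) F F' H i j := by
  have hmem : relGraph δ (s i) (s' j) (fun ξ ξ' => h (f i ξ) = f' j ξ') ∈ transitionCodes K δ :=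
    Or.inr ⟨_, _, _, hij, rfl⟩
  refine ⟨⟨_, mem_vonNeumann_of_mem_transitionCodes hα hβ hδβ hmem⟩, hmem, fun z => ?_⟩
  rw [hF.rel_iff hβ hδβ hF' hH, not_exists_mem_iff]
  exact mem_relGraph (r := fun ξ ξ' => h (f i ξ) = f' j ξ')

/-- The tag `∅`, which is not a pair, shows that `g` codes a partial isomorphism and not an
embedding; one related pair then reveals both structures. -/
theorem IsCode.isPartialIso_of_hasPartialIso (hδ : Function.Injective δ)
    (hα : Order.IsSuccLimit α) (hβ : β < α) (hδβ : ∀ p, (δ p).rank < β) (hF : IsCode δ F s f)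
    (hF' : IsCode δ F' s' f') (hH : ∀ o o', Rel₂ H (ordPoint o) (ordPoint o') ↔ h o = o')
    {i j : RankDomain α} (hij : HasPartialIso (transitionCodes K δ) F F' H i j)
    (hne : ∃ ξ ξ', h (f i ξ) = f' j ξ') :
    IsPartialIso (s i) (s' j) fun ξ ξ' => h (f i ξ) = f' j ξ' := by
  obtain ⟨g, hg, hgz⟩ := hij
  simp only [hF.rel_iff hβ hδβ hF' hH, not_exists_mem_iff] at hgz
  have hempty : ∅ ∈ g.1 := by
    refine (hgz ⟨∅, ZFSet.mem_vonNeumann.2 ?_⟩).2 (Or.inl rfl)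
    rw [ZFSet.rank_empty]
    exact hα.bot_lt
  obtain ⟨S, T, e, -, hgr⟩ | ⟨S, T, r, hr, hgr⟩ := hg
  · exact absurd (hgr ▸ hempty) empty_notMem_embGraph
  have hpair : ∀ ξ ξ', h (f i ξ) = f' j ξ' ↔ S = s i ∧ T = s' j ∧ r ξ ξ' := by
    intro ξ ξ'
    obtain ⟨z, hz⟩ := exists_isPair hα (chartPoint hβ hδβ (s i, ξ)) (chartPoint hβ hδβ (s' j, ξ'))
    have hz : z.1 = ZFSet.pair (δ (s i, ξ)) (δ (s' j, ξ')) := hz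
    have h1 := hgz z
    rw [hz, hgr, pair_mem_relGraph hδ] at h1
    rw [eq_comm (a := S), eq_comm (a := T), h1]
    constructor
    · exact fun h => Or.inr ⟨ξ, ξ', h, rfl⟩
    · rintro (h | ⟨η, η', h, h'⟩)
      · exact absurd h (ZFSet.pair_ne_empty _ _)
      · obtain ⟨h2, h3⟩ := ZFSet.pair_inj.1 h'
        rwa [(eq_of_code_eq hδ h2).2, (eq_of_code_eq hδ h3).2]
  obtain ⟨ξ, ξ', hξ⟩ := hne
  obtain ⟨rfl, rfl, -⟩ := (hpair ξ ξ').1 hξ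
  convert hr using 4
  simp [hpair]

theorem _root_.IsCodedPerm.exists_equiv (hH : IsCodedPerm H) :
    ∃ h : α.ToType ≃ α.ToType, ∀ o o', Rel₂ H (ordPoint o) (ordPoint o') ↔ h o = o' := by
  obtain ⟨h1, h2, h3⟩ := hH
  have h1' : ∀ o : α.ToType, ∃ o', Rel₂ H (ordPoint o) (ordPoint o') := fun o => by
    obtain ⟨y, hy, h⟩ := h1 _ (isOrdinal_ordPoint o)
    obtain ⟨o', rfl⟩ := exists_ordPoint hy
    exact ⟨o', h⟩
  choose h hh using h1'
  refine ⟨Equiv.ofBijective h ⟨fun o o' ho => ?_, fun o' => ?_⟩, fun o o' => ⟨fun ho => ?_, ?_⟩⟩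
  · exact ordPoint_injective ((h3 _ _ _ _ (hh o) (hh o')).2 (by rw [ho]))
  · obtain ⟨y, hy, hy'⟩ := h2 _ (isOrdinal_ordPoint o')
    obtain ⟨o, rfl⟩ := exists_ordPoint hy
    exact ⟨o, ordPoint_injective ((h3 _ _ _ _ (hh o) hy').1 rfl)⟩
  · exact ordPoint_injective ((h3 _ _ _ _ (hh o) ho).1 rfl)
  · rintro rfl
    exact hh o

theorem exists_isCodedPerm (hα : Order.IsSuccLimit α) (h : α.ToType ≃ α.ToType) :
    ∃ H, IsCodedPerm H ∧ ∀ o o', Rel₂ H (ordPoint o) (ordPoint o') ↔ h o = o' := by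
  obtain ⟨H, hH⟩ := exists_rel₂ hα fun y y' => ∃ o, y = ordPoint o ∧ y' = ordPoint (h o)
  refine ⟨H, ⟨fun y hy => ?_, fun y hy => ?_, fun y y' z z' hy hz => ?_⟩, fun o o' => ?_⟩
  · obtain ⟨o, rfl⟩ := exists_ordPoint hy
    exact ⟨_, isOrdinal_ordPoint (h o), (hH _ _).2 ⟨o, rfl, rfl⟩⟩
  · obtain ⟨o, rfl⟩ := exists_ordPoint hy
    exact ⟨_, isOrdinal_ordPoint (h.symm o), (hH _ _).2 ⟨_, rfl, by simp⟩⟩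
  · obtain ⟨o, rfl, rfl⟩ := (hH _ _).1 hy
    obtain ⟨o', rfl, rfl⟩ := (hH _ _).1 hz
    rw [ordPoint_injective.eq_iff, ordPoint_injective.eq_iff, h.injective.eq_iff]
  · rw [hH]
    constructor
    · rintro ⟨o₁, h1, h2⟩
      rw [ordPoint_injective h1, ordPoint_injective h2]
    · rintro rfl
      exact ⟨o, rfl, rfl⟩

end Coding

end AEC

/-! ### Counting structures, and categoricity as the reflected sentence -/

namespace AEC

open FirstOrder.Language FirstOrder.Language.Substructure

variable {L : FirstOrder.Language.{u, u}} {K : AEC L} {X : Type u}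

theorem IsStrongEmb.id_left {Y : Type u} {s : L.Structure X} {t : L.Structure Y} {e : X → Y}
    (h : IsStrongEmb K s t e) : IsStrongEmb K s s id := by
  obtain ⟨e, -, h⟩ := h
  have hX : K.mem X := K.mem_iso _ _ e.equivRange.symm (K.mem_of_prec _ _ h).1
  refine ⟨Embedding.refl L X, rfl, ?_⟩
  convert K.prec_refl X hX
  exact Hom.range_id

/-- The diagram of a structure, as a set of words. -/
def wordDiagram (s : L.Structure X) : Set (L.Symbols × List X) :=
  {p | (∃ (n : ℕ) (F : L.Functions n) (v : Fin n → X),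
      p = (Sum.inl ⟨n, F⟩, Structure.funMap F v :: List.ofFn v)) ∨
    ∃ (n : ℕ) (R : L.Relations n) (v : Fin n → X),
      Structure.RelMap R v ∧ p = (Sum.inr ⟨n, R⟩, List.ofFn v)}

theorem wordDiagram_injective : Function.Injective (wordDiagram (L := L) (X := X)) := by
  intro s t h
  have hrel : ∀ s t : L.Structure X, wordDiagram s = wordDiagram t → ∀ (n : ℕ)
      (R : L.Relations n) (v : Fin n → X), s.RelMap R v → t.RelMap R v := by
    intro s t h n R v hR
    have hmem : ((Sum.inr ⟨n, R⟩, List.ofFn v) : L.Symbols × List X) ∈ wordDiagram t :=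
      h ▸ Or.inr ⟨n, R, v, hR, rfl⟩
    rcases hmem with ⟨m, F, w, hw⟩ | ⟨m, R', w, hR', hw⟩
    · simp at hw
    · simp only [Prod.mk.injEq, Sum.inr.injEq, Sigma.mk.injEq] at hw
      obtain ⟨⟨rfl, hRR⟩, hvw⟩ := hw
      rw [eq_of_heq hRR, List.ofFn_injective hvw]
      exact hR'
  refine FirstOrder.Language.Structure.ext ?_ ?_
  · funext n F v
    have hmem : ((Sum.inl ⟨n, F⟩, s.funMap F v :: List.ofFn v) : L.Symbols × List X) ∈
        wordDiagram t := h ▸ Or.inl ⟨n, F, v, rfl⟩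
    rcases hmem with ⟨m, F', w, hw⟩ | ⟨m, R', w, hR', hw⟩
    · simp only [Prod.mk.injEq, Sum.inl.injEq, Sigma.mk.injEq, List.cons.injEq] at hw
      obtain ⟨⟨rfl, hFF⟩, hvw, hvw'⟩ := hw
      rw [hvw, eq_of_heq hFF, List.ofFn_injective hvw']
    · simp at hw
  · funext n R v
    exact propext ⟨hrel s t h n R v, hrel t s h.symm n R v⟩

/-- A structure is determined by its diagram, a subset of a set of size at most `#X`. -/
theorem mk_structure_le (hL : L.card ≤ #X) (hX : ℵ₀ ≤ #X) : #(L.Structure X) ≤ 2 ^ #X := by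
  have : Infinite X := Cardinal.infinite_iff.2 hX
  refine (Cardinal.mk_le_of_injective wordDiagram_injective).trans ?_
  rw [Cardinal.mk_set]
  refine Cardinal.power_le_power_left two_ne_zero ?_
  rw [Cardinal.mk_prod, Cardinal.lift_id, Cardinal.lift_id, Cardinal.mk_list_eq_mk]
  exact Cardinal.mul_le_of_le hX hL le_rfl

/-- There are sets of small rank that stand for the elements of all structures on `X`. -/
theorem exists_code (hL : L.card ≤ #X) (hX : ℵ₀ ≤ #X) :
    ∃ δ : L.Structure X × X → ZFSet.{u}, Function.Injective δ ∧
      ∀ p, (δ p).rank < Order.succ (#X).ord := by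
  obtain ⟨e⟩ : Nonempty (X ≃ (#X).ord.ToType) := Cardinal.eq.1 (by simp)
  -- Codes are sets of ordinals below `(#X).ord`. Their rank stays this small although there may be
  -- `2 ^ #X` of them, so `κ` need not be a strong limit here.
  obtain ⟨j⟩ : Nonempty (L.Structure X × X ↪ Set X) := by
    rw [← Cardinal.le_def, Cardinal.mk_prod, Cardinal.lift_id, Cardinal.lift_id, Cardinal.mk_set]
    exact Cardinal.mul_le_of_le (hX.trans (Cardinal.cantor _).le) (mk_structure_le hL hX)
      (Cardinal.cantor _).le
  let c : X → ZFSet.{u} := fun x => (ordPoint (e x)).1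
  have hc : Function.Injective c := fun x y h => e.injective (ordPoint_injective (Subtype.ext h))
  refine ⟨fun p => ZFSet.range fun x : j p => c x, fun p q h => ?_, fun p => ?_⟩
  · refine j.injective (Set.ext fun x => ?_)
    have h1 : ∀ p, x ∈ j p ↔ c x ∈ ZFSet.range fun x : j p => c x := by
      intro p
      rw [ZFSet.mem_range]
      exact ⟨fun hx => ⟨⟨x, hx⟩, rfl⟩, fun ⟨y, hy⟩ => hc hy ▸ y.2⟩
    rw [h1, h1]
    exact Iff.of_eq (congrArg (c x ∈ ·) h)
  · rw [Order.lt_succ_iff, ZFSet.rank_le_iff]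
    intro z hz
    obtain ⟨x, rfl⟩ := ZFSet.mem_range.1 hz
    exact ZFSet.mem_vonNeumann.1 (ordPoint (e x)).2

/-- Charts are indexed by points of `V_α`; its ordinals alone suffice to index the finite subsets of
`α`. -/
theorem exists_surjective_finset {α : Ordinal.{u}} (hα : ℵ₀ ≤ α.card) :
    ∃ q : RankDomain α → Finset α.ToType, Function.Surjective q := by
  have : Infinite α.ToType := Cardinal.infinite_iff.2 (by rwa [Cardinal.mk_toType])
  obtain ⟨e⟩ : Nonempty (α.ToType ≃ Finset α.ToType) := Cardinal.eq.1 (by simp)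
  exact ⟨e ∘ Function.invFun ordPoint,
    e.surjective.comp (Function.invFun_surjective ordPoint_injective)⟩

section LowenheimSkolem

variable {χ : Cardinal.{u}}

theorem isLowenheimSkolemBound_LS (K : AEC L) : IsLowenheimSkolemBound K.mem K.prec K.LS :=
  csInf_mem K.exists_lowenheimSkolem

theorem _root_.IsLowenheimSkolemBound.mono {μ : Cardinal.{u}}
    (h : IsLowenheimSkolemBound K.mem K.prec χ) (hμ : χ ≤ μ) :
    IsLowenheimSkolemBound K.mem K.prec μ := by
  refine ⟨h.1.trans hμ, fun M _ hM A => ?_⟩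
  obtain ⟨S, hS, hS', hS''⟩ := h.2 M hM A
  exact ⟨S, hS, hS', hS''.trans (add_le_add_right hμ _)⟩

theorem exists_mem_card_eq (hχ : IsLowenheimSkolemBound K.mem K.prec χ) {M : Type u}
    [L.Structure M] (hM : K.mem M) {μ : Cardinal.{u}} (hμ : χ ≤ μ) (hμ' : μ ≤ #M) :
    ∃ (N : Type u) (_ : L.Structure N), K.mem N ∧ #N = μ := by
  obtain ⟨A, hA⟩ := Cardinal.le_mk_iff_exists_set.1 hμ'
  obtain ⟨S, hS, hS', hS''⟩ := hχ.2 M hM A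
  have h : ℵ₀ ≤ χ := le_trans (by simp) hχ.1
  refine ⟨S, inferInstance, (K.mem_of_prec _ _ hS').1, le_antisymm (hS''.trans ?_) ?_⟩
  · rw [hA]
    exact Cardinal.add_le_of_le (h.trans hμ) le_rfl hμ
  · rw [← hA]
    exact Cardinal.mk_le_mk_of_subset hS

end LowenheimSkolem

section Reflection

variable {δ : L.Structure X × X → ZFSet.{u}} {α β : Ordinal.{u}}

theorem exists_isCodedAtlas (hχ : IsLowenheimSkolemBound K.mem K.prec #X)
    (hα : Order.IsSuccLimit α) (hXα : #X ≤ α.card) (hδ : Function.Injective δ) (hβ : β < α)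
    (hδβ : ∀ p, (δ p).rank < β) (t : L.Structure α.ToType) (ht : K.mem α.ToType) :
    ∃ (s : RankDomain α → L.Structure X) (f : RankDomain α → X → α.ToType)
      (F : Set (RankDomain α)), IsAtlas K s f ∧ (∀ i, IsEmb (s i) t (f i)) ∧
        (∀ i, IsStrongEmb K (s i) (s i) id) ∧ IsCodedAtlas (transitionCodes K δ) F ∧
          IsCode δ F s f := by
  have hX : ℵ₀ ≤ #X := le_trans (by simp) hχ.1
  obtain ⟨q, hq⟩ := exists_surjective_finset (hX.trans hXα)
  obtain ⟨s, f, h, hemb⟩ := exists_isAtlas hχ rfl t ht (by rwa [Cardinal.mk_toType]) q hq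
  have hs : ∀ i, IsStrongEmb K (s i) (s i) id := fun i => by
    obtain ⟨k, ⟨e, he, -⟩, -⟩ := h.directed i i
    exact he.id_left
  obtain ⟨F, hF, hF'⟩ := h.exists_isCodedAtlas hδ hα hβ hδβ hs
  exact ⟨s, f, F, h, hemb, hs, hF, hF'⟩

/-- The limits of two coded atlases are models with universe `α`, hence isomorphic; an isomorphism
restricts to partial isomorphisms between charts, whose codes are in the predicate. -/
theorem Categorical.categoricityMatrix (hχ : IsLowenheimSkolemBound K.mem K.prec #X)
    (hα : Order.IsSuccLimit α) (hXα : #X < α.card) (hδ : Function.Injective δ) (hβ : β < α)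
    (hδβ : ∀ p, (δ p).rank < β) (hcat : K.Categorical α.card) (F F' A : Set (RankDomain α)) :
    ∃ H, CategoricityMatrix α (transitionCodes K δ) F F' A H := by
  have hX : ℵ₀ ≤ #X := le_trans (by simp) hχ.1
  have : Nonempty X := Cardinal.mk_ne_zero_iff.1 (Cardinal.aleph0_pos.trans_le hX).ne'
  have : Nonempty α.ToType := Cardinal.mk_ne_zero_iff.1 (by
    rw [Cardinal.mk_toType]
    exact (Cardinal.aleph0_pos.trans_le (hX.trans hXα.le)).ne')
  -- The witness is the identity on a chart of some model of size `α.card`.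
  have hg : ∃ g : RankDomain α, g.1 ∈ transitionCodes K δ ∧ IsUntagged g := by
    obtain ⟨⟨M, _, hM, hMα⟩, -⟩ := hcat
    obtain ⟨e⟩ : Nonempty (M ≃ α.ToType) := Cardinal.eq.1 (by rw [hMα, Cardinal.mk_toType])
    let t : L.Structure α.ToType := e.inducedStructure
    obtain ⟨s, f, -, -, -, hs, -⟩ := exists_isCodedAtlas hχ hα hXα.le hδ hβ hδβ t
      (K.mem_iso _ _ e.inducedStructureEquiv hM)
    let i : RankDomain α := ordPoint (Classical.arbitrary α.ToType)
    have hmem : embGraph δ (s i) (s i) id ∈ transitionCodes K δ := Or.inl ⟨_, _, _, hs i, rfl⟩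
    exact ⟨⟨_, mem_vonNeumann_of_mem_transitionCodes hα hβ hδβ hmem⟩, hmem,
      isUntagged_iff.2 empty_notMem_embGraph⟩
  suffices h : ∃ H, IsCodedAtlas (transitionCodes K δ) F → IsCodedAtlas (transitionCodes K δ) F' →
      IsCodedPerm H ∧ ∀ i j, HasPartialIso (transitionCodes K δ) F F' H i j by
    obtain ⟨H, hH⟩ := h
    exact ⟨H, exists_isPair hα, hg, isNotOnto_of_card_lt hXα A, hH⟩
  by_cases h : IsCodedAtlas (transitionCodes K δ) F ∧ IsCodedAtlas (transitionCodes K δ) F'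
  · obtain ⟨s, f, hs, hF⟩ := h.1.exists_isAtlas hδ hα hβ hδβ
    obtain ⟨s', f', hs', hF'⟩ := h.2.exists_isAtlas hδ hα hβ hδβ
    obtain ⟨t, ht⟩ := hs.exists_structure
    obtain ⟨t', ht'⟩ := hs'.exists_structure
    have huniq := hcat.2
    obtain ⟨e⟩ := @huniq α.ToType α.ToType t t' (hs.mem t ht) (hs'.mem t' ht')
      (Cardinal.mk_toType α) (Cardinal.mk_toType α)
    obtain ⟨H, hH, hH'⟩ := exists_isCodedPerm hα
      (@FirstOrder.Language.Equiv.toEquiv L _ _ t t' e)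
    exact ⟨H, fun _ _ => ⟨hH, fun i j => hF.hasPartialIso hα hβ hδβ hF' hH'
      (isPartialIso_of_equiv t t' e (ht i) (ht' j))⟩⟩
  · exact ⟨∅, fun h1 h2 => absurd ⟨h1, h2⟩ h⟩

/-- Both models are transported to the universe `α` and presented by coded atlases; the permutation
`H` is an isomorphism because it is one chart by chart. The ordinal `α` need not be a cardinal. -/
theorem nonempty_equiv_of_categoricityMatrix (hχ : IsLowenheimSkolemBound K.mem K.prec #X)
    (hα : Order.IsSuccLimit α) (hXα : #X ≤ α.card) (hδ : Function.Injective δ) (hβ : β < α)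
    (hδβ : ∀ p, (δ p).rank < β)
    (h : ∀ F F' A, ∃ H, CategoricityMatrix α (transitionCodes K δ) F F' A H)
    {M N : Type u} [L.Structure M] [L.Structure N] (hM : K.mem M) (hN : K.mem N)
    (hMα : #M = α.card) (hNα : #N = α.card) : Nonempty (M ≃[L] N) := by
  have hX : ℵ₀ ≤ #X := le_trans (by simp) hχ.1
  have : Nonempty α.ToType := Cardinal.mk_ne_zero_iff.1 (by
    rw [Cardinal.mk_toType]
    exact (Cardinal.aleph0_pos.trans_le (hX.trans hXα)).ne')
  obtain ⟨e⟩ : Nonempty (M ≃ α.ToType) := Cardinal.eq.1 (by rw [hMα, Cardinal.mk_toType])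
  obtain ⟨e'⟩ : Nonempty (N ≃ α.ToType) := Cardinal.eq.1 (by rw [hNα, Cardinal.mk_toType])
  let t : L.Structure α.ToType := e.inducedStructure
  let t' : L.Structure α.ToType := e'.inducedStructure
  obtain ⟨s, f, F, hs, ht, -, hF, hsF⟩ := exists_isCodedAtlas hχ hα hXα hδ hβ hδβ t
    (@AEC.mem_iso L K M _ _ t e.inducedStructureEquiv hM)
  obtain ⟨s', f', F', hs', ht', -, hF', hsF'⟩ := exists_isCodedAtlas hχ hα hXα hδ hβ hδβ t'
    (@AEC.mem_iso L K N _ _ t' e'.inducedStructureEquiv hN)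
  obtain ⟨H, -, -, -, hH⟩ := h F F' ∅
  obtain ⟨hperm, hiso⟩ := hH hF hF'
  obtain ⟨g, hg⟩ := hperm.exists_equiv
  obtain ⟨g'⟩ := hs.nonempty_equiv hs' t t' ht ht' g fun i j hij =>
    hsF.isPartialIso_of_hasPartialIso hδ hα hβ hδβ hsF' hg (hiso i j) hij
  exact ⟨@FirstOrder.Language.Equiv.comp L _ _ _ t' _ _
    (@FirstOrder.Language.Equiv.symm L _ _ _ t' e'.inducedStructureEquiv)
    (@FirstOrder.Language.Equiv.comp L _ _ _ t _ t' g' e.inducedStructureEquiv)⟩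

end Reflection

end AEC

theorem mainTheorem11 (L : FirstOrder.Language.{u, u}) (K : AEC L) (κ : Cardinal.{u})
    (hκ : IsPiOneTwoIndescribable κ) (hLS : K.LS < κ) (hcat : K.Categorical κ) :
    ∀ ν : Cardinal.{u}, ν < κ → ∃ μ : Cardinal.{u}, ν < μ ∧ μ < κ ∧ K.Categorical μ := by
  intro ν hν
  -- The sentence will force `#X < α.card`, so including `ν` here places the reflected cardinal
  -- above `ν`.
  obtain ⟨X, hX⟩ : ∃ X : Type u, #X = max K.LS ν := ⟨_, Cardinal.mk_out _⟩
  have hXκ : #X < κ := hX ▸ max_lt hLS hν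
  have hχ : IsLowenheimSkolemBound K.mem K.prec #X :=
    K.isLowenheimSkolemBound_LS.mono (hX ▸ le_max_left _ _)
  have hX₀ : ℵ₀ ≤ #X := le_trans (by simp) hχ.1
  obtain ⟨δ, hδ, hδβ⟩ := AEC.exists_code (L := L) (X := X) (le_trans (by simp) hχ.1) hX₀
  have hlim : Order.IsSuccLimit κ.ord := Cardinal.isSuccLimit_ord (hX₀.trans hXκ.le)
  have hβ : Order.succ (#X).ord < κ.ord := hlim.succ_lt (Cardinal.ord_lt_ord.2 hXκ)
  obtain ⟨α, hα, h⟩ := hκ.reflect (U := AEC.transitionCodes K δ)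
    (fun x hx => AEC.mem_vonNeumann_of_mem_transitionCodes hlim hβ hδβ hx)
    (AEC.Categorical.categoricityMatrix hχ hlim (by rwa [Cardinal.card_ord]) hδ hβ hδβ
      (by rwa [Cardinal.card_ord]))
  -- These two clauses do not involve the second-order variables, so any values serve.
  obtain ⟨-, hpair, ⟨g, hg, hg'⟩, -⟩ := h ∅ ∅ ∅
  have hα' := isSuccLimit_of_exists_isPair g hpair
  have hXα : #X < α.card := AEC.card_lt_of_isNotOnto hδ hα' (fun A => by
    obtain ⟨H, hH⟩ := h ∅ ∅ A
    exact hH.2.2.1) hg hg'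
  have hβα : Order.succ (#X).ord < α := hα'.succ_lt (lt_of_not_ge fun hle =>
    hXα.not_ge (by simpa using Ordinal.card_le_card hle))
  have hακ : α.card < κ := Cardinal.lt_ord.1 hα
  obtain ⟨⟨M, _, hM, hMκ⟩, -⟩ := hcat
  refine ⟨α.card, (hX ▸ le_max_right _ _ : ν ≤ #X).trans_lt hXα, hακ,
    AEC.exists_mem_card_eq hχ hM hXα.le (hMκ ▸ hακ.le), ?_⟩
  intro M N _ _ hM hN hMα hNα
  exact AEC.nonempty_equiv_of_categoricityMatrix hχ hα' hXα.le hδ hβα hδβ h hM hN hMα hNα
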